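/- Let $\eta>0$. There is a constant $C=C(\eta)>0$, depending only on $\eta$, such that the following holds for every dimension $d$ and every $n\ge 1$. Let $\mu,\nu$ be Borel probability measures on $\mathbb R^d$ with $\|x\|\le 1/2$ for $\mu$-a.e. $x$ and $\|y\|\le 1/2$ for $\nu$-a.e. $y$ (Euclidean norm). Let $\Pi(\mu,\nu)$ be the set of couplings of $\mu$ and $\nu$ and let $$\pi_\star=\operatorname*{argmin}_{\pi\in\Pi(\mu,\nu)}\Big\{\int\|x-y\|^2\,d\pi(x,y)+\frac1\eta\,\mathsf{KL}(\pi\,\|\,\mu\otimes\nu)\Big\}$$ be the Schrödinger coupling, and $b_\star(x)=\mathbb E_{\pi_\star}[Y\mid X=x]$ the entropic regression function. Let $X_1,\dots,X_n\sim\mu$ be i.i.d. and $Y_1,\dots,Y_n\sim\nu$ be i.i.d., with the two samples independent of each other. Let $\mu_n=\frac1n\sum_i\delta_{X_i}$ and $\nu_n=\frac1n\sum_j\delta_{Y_j}$, and let $(f_n,g_n)\in L^\infty(\mu_n)\times L^\infty(\nu_n)$ be the maximizer, normalized by $\nu_n(g_n)=0$, of the empirical dual objective $$\Phi_n(f,g)=\mu_n(f)+\nu_n(g)-\frac1\eta(\mu_n\otimes\nu_n)\big(e^{-\eta(\|x-y\|^2-f(x)-g(y))}-1\big).$$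 Extend $f_n,g_n$ canonically to $\mathbb R^d$ by $$e^{-\eta f_n(x)}=\frac1n\sum_{j=1}^n e^{-\eta\|x-Y_j\|^2+\eta g_n(Y_j)},\qquad e^{-\eta g_n(y)}=\frac1n\sum_{i=1}^n e^{-\eta\|X_i-y\|^2+\eta f_n(X_i)},$$ and put $p_n(x,y)=e^{-\eta(\|x-y\|^2-f_n(x)-g_n(y))}$ and $b_n(x)=\frac1n\sum_{j=1}^n Y_j\,p_n(x,Y_j)$ for $x\in\mathbb R^d$. Then $\|b_n-b_\star\|_{L^2(\mu)}^2$ is a (measurable) random variable, $$\mathbb E\,\|b_n-b_\star\|_{L^2(\mu)}^2\le\frac Cn,$$ and for every $t>0$, with probability at least $1-8e^{-t}$, $$\|b_n-b_\star\|_{L^2(\mu)}^2\le\frac{C\,t}{n}.$$ -/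

import Mathlib

open MeasureTheory ProbabilityTheory
open scoped ENNReal

noncomputable section

namespace EntropicOT

variable {d n : ℕ}

/-- The couplings `Π(μ, ν)`: probability measures on `ℝᵈ × ℝᵈ` with marginals `μ` and `ν`. -/
def couplings (μ ν : Measure (EuclideanSpace ℝ (Fin d))) :
    Set (ProbabilityMeasure (EuclideanSpace ℝ (Fin d) × EuclideanSpace ℝ (Fin d))) :=
  {π | π.toMeasure.map Prod.fst = μ ∧ π.toMeasure.map Prod.snd = ν}

/-- The entropic cost `∫ ‖x - y‖² dπ + (1/η) KL(π ‖ μ ⊗ ν)`, with values in `[0, ∞]`. -/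
def entropicCost (η : ℝ) (μ ν : Measure (EuclideanSpace ℝ (Fin d)))
    (π : ProbabilityMeasure (EuclideanSpace ℝ (Fin d) × EuclideanSpace ℝ (Fin d))) : ℝ≥0∞ :=
  (∫⁻ z, ‖z.1 - z.2‖ₑ ^ 2 ∂π.toMeasure) +
    ENNReal.ofReal (1 / η) * InformationTheory.klDiv π.toMeasure (μ.prod ν)

/-- `π` minimizes the entropic cost among all couplings of `μ` and `ν`. -/
def IsSchrodingerCoupling (η : ℝ) (μ ν : Measure (EuclideanSpace ℝ (Fin d)))
    (π : ProbabilityMeasure (EuclideanSpace ℝ (Fin d) × EuclideanSpace ℝ (Fin d))) : Prop :=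
  π ∈ couplings μ ν ∧ ∀ π' ∈ couplings μ ν, entropicCost η μ ν π ≤ entropicCost η μ ν π'

/-- The Schrödinger coupling: the minimizer of the entropic cost over `Π(μ, ν)`. -/
def schrodingerCoupling (η : ℝ) (μ ν : Measure (EuclideanSpace ℝ (Fin d))) :
    ProbabilityMeasure (EuclideanSpace ℝ (Fin d) × EuclideanSpace ℝ (Fin d)) :=
  Classical.epsilon (IsSchrodingerCoupling η μ ν)

/-- The entropic regression function `b⋆(x) = E_{π⋆}[Y | X = x]`: the barycenter of the
conditional law of the second coordinate given the first one under `π⋆`. -/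
def regression (η : ℝ) (μ ν : Measure (EuclideanSpace ℝ (Fin d)))
    (x : EuclideanSpace ℝ (Fin d)) : EuclideanSpace ℝ (Fin d) :=
  ∫ y, y ∂((schrodingerCoupling η μ ν).toMeasure.condKernel x)

/-- The dual objective
`P(f) + Q(g) - (1/η) (P ⊗ Q)(exp(-η (‖x - y‖² - f(x) - g(y))) - 1)`. -/
def dualObjective (η : ℝ) (P Q : Measure (EuclideanSpace ℝ (Fin d)))
    (f g : EuclideanSpace ℝ (Fin d) → ℝ) : ℝ :=
  (∫ x, f x ∂P) + (∫ y, g y ∂Q) -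
    1 / η * ∫ z, (Real.exp (-η * (‖z.1 - z.2‖ ^ 2 - f z.1 - g z.2)) - 1) ∂(P.prod Q)

/-- `(f, g)` maximizes the dual objective over `L^∞(P) × L^∞(Q)`, normalized by `Q(g) = 0`. -/
def IsDualPotentials (η : ℝ) (P Q : Measure (EuclideanSpace ℝ (Fin d)))
    (fg : (EuclideanSpace ℝ (Fin d) → ℝ) × (EuclideanSpace ℝ (Fin d) → ℝ)) : Prop :=
  MemLp fg.1 ∞ P ∧ MemLp fg.2 ∞ Q ∧ ∫ y, fg.2 y ∂Q = 0 ∧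
    ∀ f g : EuclideanSpace ℝ (Fin d) → ℝ, MemLp f ∞ P → MemLp g ∞ Q →
      dualObjective η P Q f g ≤ dualObjective η P Q fg.1 fg.2

/-- The normalized optimal dual potentials (unique up to null sets). -/
def dualPotentials (η : ℝ) (P Q : Measure (EuclideanSpace ℝ (Fin d))) :
    (EuclideanSpace ℝ (Fin d) → ℝ) × (EuclideanSpace ℝ (Fin d) → ℝ) :=
  Classical.epsilon (IsDualPotentials η P Q)

/-- The empirical measure `(1/n) ∑ᵢ δ_{xᵢ}`. -/
def empMeasure (x : Fin n → EuclideanSpace ℝ (Fin d)) : Measure (EuclideanSpace ℝ (Fin d)) :=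
  (n : ℝ≥0∞)⁻¹ • ∑ i, Measure.dirac (x i)

/-- The canonical extension to `ℝᵈ` attached to data points `y` and a potential `g` on them: the
function `f` with `exp(-η f(x)) = (1/n) ∑ⱼ exp(-η ‖x - yⱼ‖² + η g(yⱼ))` for all `x`. -/
def canonicalExtension (η : ℝ) (y : Fin n → EuclideanSpace ℝ (Fin d))
    (g : EuclideanSpace ℝ (Fin d) → ℝ) (x : EuclideanSpace ℝ (Fin d)) : ℝ :=
  -(1 / η) * Real.log ((n : ℝ)⁻¹ * ∑ j, Real.exp (-η * ‖x - y j‖ ^ 2 + η * g (y j)))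

/-- The extended empirical potential `f_n` for the samples `x`, `y`. -/
def empPotentialLeft (η : ℝ) (x y : Fin n → EuclideanSpace ℝ (Fin d)) :
    EuclideanSpace ℝ (Fin d) → ℝ :=
  canonicalExtension η y (dualPotentials η (empMeasure x) (empMeasure y)).2

/-- The extended empirical potential `g_n` for the samples `x`, `y`. -/
def empPotentialRight (η : ℝ) (x y : Fin n → EuclideanSpace ℝ (Fin d)) :
    EuclideanSpace ℝ (Fin d) → ℝ :=
  canonicalExtension η x (dualPotentials η (empMeasure x) (empMeasure y)).1

/-- The extended empirical density `p_n(u, v) = exp(-η (‖u - v‖² - f_n(u) - g_n(v)))`. -/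
def empDensity (η : ℝ) (x y : Fin n → EuclideanSpace ℝ (Fin d))
    (u v : EuclideanSpace ℝ (Fin d)) : ℝ :=
  Real.exp (-η * (‖u - v‖ ^ 2 - empPotentialLeft η x y u - empPotentialRight η x y v))

/-- The extended empirical entropic regression function `b_n(u) = (1/n) ∑ⱼ yⱼ p_n(u, yⱼ)`. -/
def empRegression (η : ℝ) (x y : Fin n → EuclideanSpace ℝ (Fin d))
    (u : EuclideanSpace ℝ (Fin d)) : EuclideanSpace ℝ (Fin d) :=
  (n : ℝ)⁻¹ • ∑ j, empDensity η x y u (y j) • y j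

/-- The squared error `‖b_n - b⋆‖²_{L²(μ)}`. -/
def sqError (η : ℝ) (μ ν : Measure (EuclideanSpace ℝ (Fin d)))
    (x y : Fin n → EuclideanSpace ℝ (Fin d)) : ℝ≥0∞ :=
  eLpNorm (fun u => empRegression η x y u - regression η μ ν u) 2 μ ^ 2

end EntropicOT

end

/-!
The proof bounds an exponential moment: if `W` is the squared `L²(μ)` error, then
`𝔼 exp(n W / C₀) ≤ 2` with `C₀` depending only on `η` (`lintegral_exp_intSqError_le`). The bound on
the mean and, by Markov's inequality, the deviation bound both follow.

*Potentials.* For an arbitrary measurable cost with values in `[0, 1]`, the soft-min transform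
contracts the oscillation seminorm by the factor `1 - exp(-2η)` (`softmin_contract`). Hence
Sinkhorn's iteration converges, its limit solves the Schrödinger system everywhere, and the
density `p = exp(-η (c - f - g))` takes its values in `[exp(-2η), exp(2η)]`. The construction is
used twice, with the squared distance truncated at `1`. For the population measures it gives a
density `p⋆`; completing the relative entropy shows that `p⋆ (μ ⊗ ν)` is the unique minimizer of the
entropic cost (`schrodingerCoupling_eq`), so `b⋆(u) = ∫ v p⋆(u, v) dν(v)`. For the data it
gives vectors which depend measurably on the sample and which agree with every maximizer
of the empirical dual objective, by strict concavity (`dualPotentials_empMeasure`).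

*Stability.* In `b_n(u)` the potential `f_n` cancels: `b_n(u)` is the barycenter of the points `Yⱼ`
with weights proportional to `exp(-η ‖u - Yⱼ‖² + η g_n(Yⱼ))`, for every `u`. Replacing `g_n` by `g⋆`
costs at most a multiple of the `L²(ν_n)` distance of `g_n` and `g⋆` modulo constants. Strong
concavity of the dual objective bounds this distance by the residuals
`1/n ∑ⱼ p⋆(Xᵢ, Yⱼ) - 1` and `1/n ∑ᵢ p⋆(Xᵢ, Yⱼ) - 1` of the population potentials in the empirical
Schrödinger system (`mean_sq_potential_le`). After the replacement, the remaining error at `u` is,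
up to a bounded factor, the mean of the centred vectors `p⋆(u, Yⱼ) (Yⱼ - b⋆(u))`.

*Concentration.* By Jensen's inequality the exponential of an average of squares is at most the
average of the exponentials, so it suffices to bound the exponential moment of
`‖ξ(Y₁) + ⋯ + ξ(Yₙ)‖² / n` for one bounded centred `ξ` at a time, without dependence on the
dimension. Linearizing the square with a standard Gaussian vector reduces this to the elementary
inequality `exp z ≤ z + exp(z²)` (`lintegral_exp_norm_sum_sq_le`).
-/

namespace EntropicOT

/-! ### Exponential moments of sums of bounded centred vectors -/

/-- The elementary inequality behind the sub-Gaussian bound for bounded centred variables. -/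
lemma exp_le_add_exp_sq (z : ℝ) : Real.exp z ≤ z + Real.exp (z ^ 2) := by
  have h1 : z ^ 2 + 1 ≤ Real.exp (z ^ 2) := Real.add_one_le_exp _
  rcases le_or_gt |z| 1 with h | h
  · have := (abs_le.1 (Real.abs_exp_sub_one_sub_id_le h)).2
    linarith
  · rcases lt_abs.1 h with h | h
    · have : Real.exp z ≤ Real.exp (z ^ 2) := Real.exp_le_exp.2 (by nlinarith)
      linarith
    · have : Real.exp z ≤ 1 := Real.exp_le_one_iff.2 (by linarith)
      nlinarith

/-- A bounded centred real random variable has its Laplace transform dominated by the Laplace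
transform of its square. -/
lemma integral_exp_le_integral_exp_sq {β : Type*} [MeasurableSpace β] {ν : Measure β}
    [IsProbabilityMeasure ν] {ζ : β → ℝ} (hζ : AEStronglyMeasurable ζ ν) {B : ℝ}
    (hB : ∀ᵐ y ∂ν, |ζ y| ≤ B) (h0 : ∫ y, ζ y ∂ν = 0) :
    ∫ y, Real.exp (ζ y) ∂ν ≤ ∫ y, Real.exp (ζ y ^ 2) ∂ν := by
  have hi : Integrable ζ ν := Integrable.of_bound hζ B hB
  have hi1 : Integrable (fun y => Real.exp (ζ y)) ν := by
    refine Integrable.of_bound (Real.continuous_exp.comp_aestronglyMeasurable hζ) (Real.exp B) ?_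
    filter_upwards [hB] with y hy
    rw [Real.norm_eq_abs, Real.abs_exp]
    exact Real.exp_le_exp.2 ((le_abs_self _).trans hy)
  have hi2 : Integrable (fun y => Real.exp (ζ y ^ 2)) ν := by
    refine Integrable.of_bound (Real.continuous_exp.comp_aestronglyMeasurable (hζ.pow 2))
      (Real.exp (B ^ 2)) ?_
    filter_upwards [hB] with y hy
    rw [Real.norm_eq_abs, Real.abs_exp]
    exact Real.exp_le_exp.2 (sq_le_sq' (by linarith [neg_abs_le (ζ y)]) ((le_abs_self _).trans hy))
  calc ∫ y, Real.exp (ζ y) ∂ν ≤ ∫ y, (ζ y + Real.exp (ζ y ^ 2)) ∂ν :=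
        integral_mono hi1 (hi.add hi2) fun y => exp_le_add_exp_sq _
    _ = _ := by rw [integral_add hi hi2, h0, zero_add]

/-- A sub-Gaussian type bound with the square of the variable kept inside the expectation. -/
lemma integral_exp_pow_le {β : Type*} [MeasurableSpace β] {ν : Measure β}
    [IsProbabilityMeasure ν] {ζ : β → ℝ} (hζ : AEStronglyMeasurable ζ ν) {B : ℝ}
    (hB : ∀ᵐ y ∂ν, |ζ y| ≤ B) (h0 : ∫ y, ζ y ∂ν = 0) (n : ℕ) :
    (∫ y, Real.exp (ζ y) ∂ν) ^ n ≤ ∫ y, Real.exp (n * ζ y ^ 2) ∂ν := by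
  have hb : ∀ k : ℝ, 0 ≤ k → Integrable (fun y => Real.exp (k * ζ y ^ 2)) ν := fun k hk => by
    refine Integrable.of_bound
      (Real.continuous_exp.comp_aestronglyMeasurable ((hζ.pow 2).const_mul k))
      (Real.exp (k * B ^ 2)) ?_
    filter_upwards [hB] with y hy
    rw [Real.norm_eq_abs, Real.abs_exp]
    exact Real.exp_le_exp.2 (mul_le_mul_of_nonneg_left
      (sq_le_sq' (by linarith [neg_abs_le (ζ y)]) ((le_abs_self _).trans hy)) hk)
  have hb1 : Integrable (fun y => Real.exp (ζ y ^ 2)) ν := by simpa using hb 1 zero_le_one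
  have hp : ∀ y, Real.exp (ζ y ^ 2) ^ n = Real.exp (n * ζ y ^ 2) := fun y =>
    (Real.exp_nat_mul _ _).symm
  calc (∫ y, Real.exp (ζ y) ∂ν) ^ n ≤ (∫ y, Real.exp (ζ y ^ 2) ∂ν) ^ n :=
        pow_le_pow_left₀ (integral_nonneg fun y => (Real.exp_pos _).le)
          (integral_exp_le_integral_exp_sq hζ hB h0) n
    _ ≤ ∫ y, Real.exp (ζ y ^ 2) ^ n ∂ν := by
        refine (convexOn_pow n).map_integral_le (continuous_pow n).continuousOn isClosed_Ici
          (ae_of_all _ fun y => (Real.exp_pos _).le) hb1 ?_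
        simpa [Function.comp_def, hp] using hb n n.cast_nonneg
    _ = _ := by simp_rw [hp]

lemma lintegral_exp_sq_div_four_gaussianReal :
    ∫⁻ h, ENNReal.ofReal (Real.exp (h ^ 2 / 4)) ∂(gaussianReal 0 1) ≤ 2 := by
  have hm : Measurable fun h : ℝ => ENNReal.ofReal (Real.exp (h ^ 2 / 4)) := by fun_prop
  rw [gaussianReal_of_var_ne_zero _ one_ne_zero,
    lintegral_withDensity_eq_lintegral_mul _ (measurable_gaussianPDF 0 1) hm]
  have h1 : ∀ h : ℝ, (gaussianPDF 0 1 * fun h : ℝ => ENNReal.ofReal (Real.exp (h ^ 2 / 4))) h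
      = ENNReal.ofReal ((√(2 * Real.pi))⁻¹ * Real.exp (-(1 / 4) * h ^ 2)) := by
    intro h
    rw [Pi.mul_apply, gaussianPDF, ← ENNReal.ofReal_mul (gaussianPDFReal_nonneg _ _ _),
      gaussianPDFReal]
    congr 1
    rw [mul_assoc, ← Real.exp_add]
    simp only [NNReal.coe_one, mul_one, sub_zero]
    ring_nf
  simp_rw [h1]
  rw [← ofReal_integral_eq_lintegral_ofReal
    ((integrable_exp_neg_mul_sq (by norm_num : (0 : ℝ) < 1 / 4)).const_mul _)
    (ae_of_all _ fun h => by positivity), integral_const_mul, integral_gaussian]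
  refine (ENNReal.ofReal_le_ofReal (q := 2) ?_).trans (by simp)
  rw [inv_mul_le_iff₀ (by positivity)]
  refine Real.sqrt_le_iff.2 ⟨by positivity, ?_⟩
  rw [mul_pow, Real.sq_sqrt (by positivity)]
  nlinarith [Real.pi_pos]

section Gaussian

variable {E : Type*} [NormedAddCommGroup E] [InnerProductSpace ℝ E] [FiniteDimensional ℝ E]
  [MeasurableSpace E] [BorelSpace E]

lemma map_inner_stdGaussian (v : E) :
    (stdGaussian E).map (fun g => inner ℝ v g) = gaussianReal 0 (‖v‖ ^ 2).toNNReal := by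
  have h := IsGaussian.map_eq_gaussianReal (μ := stdGaussian E) (innerSL ℝ v)
  rw [integral_strongDual_stdGaussian, variance_dual_stdGaussian, innerSL_apply_norm] at h
  exact h

/-- Linearization of the squared norm by a Gaussian vector. -/
lemma lintegral_exp_inner_stdGaussian (v : E) (s : ℝ) :
    ∫⁻ g, ENNReal.ofReal (Real.exp (s * inner ℝ v g)) ∂(stdGaussian E)
      = ENNReal.ofReal (Real.exp (s ^ 2 / 2 * ‖v‖ ^ 2)) := by
  have hi : Integrable (fun h : ℝ => Real.exp (s * h)) (gaussianReal 0 (‖v‖ ^ 2).toNNReal) :=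
    integrable_exp_mul_gaussianReal s
  have hm : Measurable fun g : E => inner ℝ v g := by fun_prop
  rw [← map_inner_stdGaussian v, integrable_map_measure (by fun_prop) hm.aemeasurable] at hi
  simp only [Function.comp_def] at hi
  rw [← ofReal_integral_eq_lintegral_ofReal hi (ae_of_all _ fun g => (Real.exp_pos _).le)]
  congr 1
  have := mgf_gaussianReal (map_inner_stdGaussian v) s
  rw [mgf] at this
  rw [this, Real.coe_toNNReal _ (by positivity)]
  ring_nf

lemma lintegral_exp_inner_sq_stdGaussian (v : E) {q : ℝ} (hq : q * ‖v‖ ^ 2 ≤ 1 / 4) :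
    ∫⁻ g, ENNReal.ofReal (Real.exp (q * inner ℝ v g ^ 2)) ∂(stdGaussian E) ≤ 2 := by
  have hm : Measurable fun g : E => inner ℝ v g := by fun_prop
  have hmap : (stdGaussian E).map (fun g => inner ℝ v g)
      = (gaussianReal 0 1).map (fun h => ‖v‖ * h) := by
    rw [map_inner_stdGaussian, gaussianReal_map_const_mul]
    congr 1
    · simp
    · ext; simp
  have h1 : Measurable fun h : ℝ => ENNReal.ofReal (Real.exp (q * h ^ 2)) := by fun_prop
  rw [← lintegral_map (f := fun h : ℝ => ENNReal.ofReal (Real.exp (q * h ^ 2))) h1 hm, hmap,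
    lintegral_map h1 (by fun_prop)]
  refine le_trans (lintegral_mono fun h => ?_) lintegral_exp_sq_div_four_gaussianReal
  refine ENNReal.ofReal_le_ofReal (Real.exp_le_exp.2 ?_)
  nlinarith [mul_le_mul_of_nonneg_right hq (sq_nonneg h)]

/-- Dimension-free exponential moment for the squared norm of a sum of independent, identically
distributed, bounded and centred vectors. -/
lemma lintegral_exp_norm_sum_sq_le {β : Type*} [MeasurableSpace β] {ν : Measure β}
    [IsProbabilityMeasure ν] {ξ : β → E} (hξ : Measurable ξ) {B : ℝ} (hB : ∀ᵐ y ∂ν, ‖ξ y‖ ≤ B)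
    (h0 : ∫ y, ξ y ∂ν = 0) (n : ℕ) {a : ℝ} (ha : 0 ≤ a) (hn : 8 * n * B ^ 2 * a ≤ 1) :
    ∫⁻ y, ENNReal.ofReal (Real.exp (a * ‖∑ j, ξ (y j)‖ ^ 2)) ∂(Measure.pi fun _ : Fin n => ν)
      ≤ 2 := by
  have hB0 : 0 ≤ B := by
    obtain ⟨y, hy⟩ := hB.exists
    exact (norm_nonneg _).trans hy
  -- with `s² = 2a` the Gaussian linearization of `exp (a ‖v‖²)` is the mean of `exp (s ⟪v, g⟫)`
  obtain ⟨s, hs⟩ : ∃ s : ℝ, s ^ 2 = 2 * a := ⟨√(2 * a), Real.sq_sqrt (by positivity)⟩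
  have hint : Integrable ξ ν := Integrable.of_bound hξ.aestronglyMeasurable B hB
  -- for a fixed direction the sum is a sum of independent real variables
  have key : ∀ g : E,
      ∫⁻ y, ENNReal.ofReal (Real.exp (s * inner ℝ (∑ j, ξ (y j)) g))
          ∂(Measure.pi fun _ : Fin n => ν)
        ≤ ∫⁻ y, ENNReal.ofReal (Real.exp (n * s ^ 2 * inner ℝ (ξ y) g ^ 2)) ∂ν := by
    intro g
    have hζ : Measurable fun y => s * inner ℝ (ξ y) g := by fun_prop
    have hζB : ∀ᵐ y ∂ν, |s * inner ℝ (ξ y) g| ≤ |s| * (B * ‖g‖) := by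
      filter_upwards [hB] with y hy
      rw [abs_mul]
      refine mul_le_mul_of_nonneg_left ((abs_real_inner_le_norm _ _).trans ?_) (abs_nonneg s)
      exact mul_le_mul_of_nonneg_right hy (norm_nonneg g)
    have hζ0 : ∫ y, s * inner ℝ (ξ y) g ∂ν = 0 := by
      rw [integral_const_mul]
      simp_rw [real_inner_comm g]
      rw [integral_inner hint, h0, inner_zero_right, mul_zero]
    have hind : iIndepFun (fun (j : Fin n) (y : Fin n → β) =>
        ENNReal.ofReal (Real.exp (s * inner ℝ (ξ (y j)) g))) (Measure.pi fun _ : Fin n => ν) :=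
      iIndepFun_pi (X := fun _ y => ENNReal.ofReal (Real.exp (s * inner ℝ (ξ y) g)))
        (fun _ => by fun_prop)
    have hprod : ∀ y : Fin n → β, ENNReal.ofReal (Real.exp (s * inner ℝ (∑ j, ξ (y j)) g))
        = ∏ j, ENNReal.ofReal (Real.exp (s * inner ℝ (ξ (y j)) g)) := by
      intro y
      rw [← ENNReal.ofReal_prod_of_nonneg (fun j _ => (Real.exp_pos _).le), ← Real.exp_sum,
        sum_inner, Finset.mul_sum]
    have hone : ∀ j : Fin n, ∫⁻ y, ENNReal.ofReal (Real.exp (s * inner ℝ (ξ (y j)) g))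
        ∂(Measure.pi fun _ : Fin n => ν)
        = ∫⁻ y, ENNReal.ofReal (Real.exp (s * inner ℝ (ξ y) g)) ∂ν := fun j =>
      (measurePreserving_eval (fun _ : Fin n => ν) j).lintegral_comp
        (f := fun y => ENNReal.ofReal (Real.exp (s * inner ℝ (ξ y) g))) (by fun_prop)
    simp_rw [hprod]
    rw [lintegral_prod_eq_prod_lintegral_of_indepFun _ _ hind (fun j => by fun_prop)]
    simp_rw [hone]
    rw [Finset.prod_const, Finset.card_univ, Fintype.card_fin]
    have hi1 : Integrable (fun y => Real.exp (s * inner ℝ (ξ y) g)) ν := by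
      refine Integrable.of_bound (by fun_prop) (Real.exp (|s| * (B * ‖g‖))) ?_
      filter_upwards [hζB] with y hy
      rw [Real.norm_eq_abs, Real.abs_exp]
      exact Real.exp_le_exp.2 ((le_abs_self _).trans hy)
    have hi2 : Integrable (fun y => Real.exp (n * s ^ 2 * inner ℝ (ξ y) g ^ 2)) ν := by
      refine Integrable.of_bound (by fun_prop) (Real.exp (n * (|s| * (B * ‖g‖)) ^ 2)) ?_
      filter_upwards [hζB] with y hy
      rw [Real.norm_eq_abs, Real.abs_exp]
      refine Real.exp_le_exp.2 ?_
      rw [mul_assoc, ← mul_pow, ← sq_abs (s * _)]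
      gcongr
    rw [← ofReal_integral_eq_lintegral_ofReal hi1 (ae_of_all _ fun g => (Real.exp_pos _).le),
      ← ofReal_integral_eq_lintegral_ofReal hi2 (ae_of_all _ fun g => (Real.exp_pos _).le),
      ← ENNReal.ofReal_pow (integral_nonneg fun y => (Real.exp_pos _).le)]
    refine ENNReal.ofReal_le_ofReal
      ((integral_exp_pow_le hζ.aestronglyMeasurable hζB hζ0 n).trans_eq ?_)
    simp_rw [mul_pow, mul_assoc]
  calc ∫⁻ y, ENNReal.ofReal (Real.exp (a * ‖∑ j, ξ (y j)‖ ^ 2)) ∂(Measure.pi fun _ : Fin n => ν)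
      = ∫⁻ y, ∫⁻ g, ENNReal.ofReal (Real.exp (s * inner ℝ (∑ j, ξ (y j)) g)) ∂(stdGaussian E)
          ∂(Measure.pi fun _ : Fin n => ν) := by
        simp_rw [lintegral_exp_inner_stdGaussian, hs]
        congr! 6
        ring
    _ = ∫⁻ g, ∫⁻ y, ENNReal.ofReal (Real.exp (s * inner ℝ (∑ j, ξ (y j)) g))
          ∂(Measure.pi fun _ : Fin n => ν) ∂(stdGaussian E) :=
        lintegral_lintegral_swap (by fun_prop)
    _ ≤ ∫⁻ g, ∫⁻ y, ENNReal.ofReal (Real.exp (n * s ^ 2 * inner ℝ (ξ y) g ^ 2)) ∂ν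
          ∂(stdGaussian E) := lintegral_mono key
    _ = ∫⁻ y, ∫⁻ g, ENNReal.ofReal (Real.exp (n * s ^ 2 * inner ℝ (ξ y) g ^ 2)) ∂(stdGaussian E)
          ∂ν := lintegral_lintegral_swap (by fun_prop)
    _ ≤ ∫⁻ _, 2 ∂ν := by
        refine lintegral_mono_ae ?_
        filter_upwards [hB] with y hy
        refine lintegral_exp_inner_sq_stdGaussian _ ?_
        have : ‖ξ y‖ ^ 2 ≤ B ^ 2 := by gcongr
        rw [hs]
        nlinarith [mul_le_mul_of_nonneg_left this (by positivity : 0 ≤ n * (2 * a))]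
    _ = 2 := by simp

end Gaussian

/-! ### The soft-min transform and Sinkhorn's iteration -/

open Filter Topology

/-- The soft-min transform `x ↦ -(1/η) log ∫ exp(-η c(x, y) + η g(y)) dν(y)`: the potential on `α`
which solves the first Schrödinger equation when the potential on `β` is `g`. -/
noncomputable def softmin {α β : Type*} [MeasurableSpace β] (η : ℝ) (ν : Measure β)
    (c : α → β → ℝ) (g : β → ℝ) (x : α) : ℝ :=
  -(1 / η) * Real.log (∫ y, Real.exp (-η * c x y + η * g y) ∂ν)

/-- Sinkhorn's iteration for the second potential, started at `0` and recentred at each step so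
that its `ν`-mean vanishes. -/
noncomputable def sinkhornIter {α β : Type*} [MeasurableSpace α] [MeasurableSpace β] (η : ℝ)
    (μ : Measure α) (ν : Measure β) (c : α → β → ℝ) : ℕ → β → ℝ
  | 0 => 0
  | k + 1 => fun y =>
      softmin η μ (fun y x => c x y) (softmin η ν c (sinkhornIter η μ ν c k)) y -
        ∫ z, softmin η μ (fun y x => c x y) (softmin η ν c (sinkhornIter η μ ν c k)) z ∂ν

/-- The limit of Sinkhorn's iteration: the second Schrödinger potential with `ν`-mean `0`. -/
noncomputable def sinkhornPotential {α β : Type*} [MeasurableSpace α] [MeasurableSpace β] (η : ℝ)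
    (μ : Measure α) (ν : Measure β) (c : α → β → ℝ) (y : β) : ℝ :=
  limUnder atTop fun k => sinkhornIter η μ ν c k y

section Softmin

variable {α β : Type*} [MeasurableSpace α] [MeasurableSpace β] {η : ℝ} {ν : Measure β}
  [IsProbabilityMeasure ν] {c : α → β → ℝ} {g : β → ℝ} {K : ℝ}

lemma integrable_gibbs (hη : 0 < η) (hc : Measurable (Function.uncurry c))
    (h0 : ∀ x y, 0 ≤ c x y) (hg : Measurable g) (hK : ∀ y, |g y| ≤ K) (x : α) :
    Integrable (fun y => Real.exp (-η * c x y + η * g y)) ν := by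
  have hcx : Measurable (c x) := hc.comp measurable_prodMk_left
  refine Integrable.of_bound (by fun_prop) (Real.exp (η * K)) (ae_of_all _ fun y => ?_)
  rw [Real.norm_eq_abs, Real.abs_exp]
  refine Real.exp_le_exp.2 ?_
  nlinarith [h0 x y, (abs_le.1 (hK y)).2]

lemma integral_gibbs_pos (hη : 0 < η) (hc : Measurable (Function.uncurry c))
    (h0 : ∀ x y, 0 ≤ c x y) (hg : Measurable g) (hK : ∀ y, |g y| ≤ K) (x : α) :
    0 < ∫ y, Real.exp (-η * c x y + η * g y) ∂ν :=
  integral_exp_pos (integrable_gibbs hη hc h0 hg hK x)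

lemma exp_neg_mul_softmin (hη : 0 < η) (hc : Measurable (Function.uncurry c))
    (h0 : ∀ x y, 0 ≤ c x y) (hg : Measurable g) (hK : ∀ y, |g y| ≤ K) (x : α) :
    Real.exp (-η * softmin η ν c g x) = ∫ y, Real.exp (-η * c x y + η * g y) ∂ν := by
  rw [softmin, ← mul_assoc, show -η * -(1 / η) = 1 by field_simp, one_mul,
    Real.exp_log (integral_gibbs_pos hη hc h0 hg hK x)]

lemma integral_density_softmin (hη : 0 < η) (hc : Measurable (Function.uncurry c))
    (h0 : ∀ x y, 0 ≤ c x y) (hg : Measurable g) (hK : ∀ y, |g y| ≤ K) (x : α) :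
    ∫ y, Real.exp (-η * (c x y - softmin η ν c g x - g y)) ∂ν = 1 := by
  have h1 : ∀ y, Real.exp (-η * (c x y - softmin η ν c g x - g y))
      = Real.exp (η * softmin η ν c g x) * Real.exp (-η * c x y + η * g y) := fun y => by
    rw [← Real.exp_add]; ring_nf
  simp_rw [h1]
  rw [integral_const_mul, ← exp_neg_mul_softmin hη hc h0 hg hK, ← Real.exp_add]
  simp

lemma measurable_softmin (hc : Measurable (Function.uncurry c)) (hg : Measurable g) :
    Measurable (softmin η ν c g) := by
  have h : StronglyMeasurable (Function.uncurry fun x y => Real.exp (-η * c x y + η * g y)) := by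
    refine Measurable.stronglyMeasurable ?_
    have : Measurable fun z : α × β => c z.1 z.2 := hc
    simp only [Function.uncurry_def]
    fun_prop
  have h2 := h.integral_prod_right' (ν := ν)
  simp only [Function.uncurry_def] at h2
  exact (Real.measurable_log.comp h2.measurable).const_mul _

lemma softmin_sub_le_one (hη : 0 < η) (hc : Measurable (Function.uncurry c))
    (h0 : ∀ x y, 0 ≤ c x y) (h1 : ∀ x y, c x y ≤ 1) (hg : Measurable g) (hK : ∀ y, |g y| ≤ K)
    (x x' : α) : softmin η ν c g x - softmin η ν c g x' ≤ 1 := by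
  have h : Real.exp (-η * softmin η ν c g x')
      ≤ Real.exp η * Real.exp (-η * softmin η ν c g x) := by
    rw [exp_neg_mul_softmin hη hc h0 hg hK, exp_neg_mul_softmin hη hc h0 hg hK,
      ← integral_const_mul]
    refine integral_mono (integrable_gibbs hη hc h0 hg hK _)
      ((integrable_gibbs hη hc h0 hg hK _).const_mul _) fun y => ?_
    simp only
    rw [← Real.exp_add]
    refine Real.exp_le_exp.2 ?_
    nlinarith [h0 x' y, h1 x y]
  rw [← Real.exp_add, Real.exp_le_exp] at h
  nlinarith

lemma abs_softmin_le (hη : 0 < η) (hc : Measurable (Function.uncurry c))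
    (h0 : ∀ x y, 0 ≤ c x y) (h1 : ∀ x y, c x y ≤ 1) (hg : Measurable g) (hK : ∀ y, |g y| ≤ K)
    (x : α) : |softmin η ν c g x| ≤ K + 1 := by
  have hu : Real.exp (-η * softmin η ν c g x) ≤ Real.exp (η * K) := by
    rw [exp_neg_mul_softmin hη hc h0 hg hK]
    calc _ ≤ ∫ _, Real.exp (η * K) ∂ν :=
          integral_mono (integrable_gibbs hη hc h0 hg hK _) (integrable_const _) fun y =>
            Real.exp_le_exp.2 (by nlinarith [h0 x y, (abs_le.1 (hK y)).2])
      _ = _ := by simp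
  have hl : Real.exp (-(η * (K + 1))) ≤ Real.exp (-η * softmin η ν c g x) := by
    rw [exp_neg_mul_softmin hη hc h0 hg hK]
    calc _ = ∫ _, Real.exp (-(η * (K + 1))) ∂ν := by simp
      _ ≤ _ := integral_mono (integrable_const _) (integrable_gibbs hη hc h0 hg hK _) fun y =>
            Real.exp_le_exp.2 (by nlinarith [h1 x y, (abs_le.1 (hK y)).1])
  rw [Real.exp_le_exp] at hu hl
  rw [abs_le]
  constructor <;> nlinarith

/-- The soft-min transform contracts the oscillation seminorm: two Gibbs measures
`∝ exp(-η c(x, ·) + η g) ν` at different points `x` have a common part of mass at least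
`exp(-2η)`. -/
lemma softmin_contract (hη : 0 < η) (hc : Measurable (Function.uncurry c))
    (h0 : ∀ x y, 0 ≤ c x y) (h1 : ∀ x y, c x y ≤ 1) {g' : β → ℝ}
    (hg : Measurable g) (hK : ∀ y, |g y| ≤ K) (hg' : Measurable g') (hK' : ∀ y, |g' y| ≤ K)
    {D : ℝ} (hD : ∀ y y', (g y - g' y) - (g y' - g' y') ≤ D) (x x' : α) :
    (softmin η ν c g x - softmin η ν c g' x) - (softmin η ν c g x' - softmin η ν c g' x')
      ≤ (1 - Real.exp (-2 * η)) * D := by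
  have : Nonempty β := ν.nonempty_of_neZero
  set δ := Real.exp (-2 * η) with hδ
  have hδ0 : 0 < δ := Real.exp_pos _
  have hδ1 : δ ≤ 1 := Real.exp_le_one_iff.2 (by linarith)
  set m : ℝ := ⨅ y, (g y - g' y) with hm
  have hbdd : BddBelow (Set.range fun y => g y - g' y) := ⟨-(2 * K), by
    rintro _ ⟨y, rfl⟩
    linarith [(abs_le.1 (hK y)).1, (abs_le.1 (hK' y)).2]⟩
  have hml : ∀ y, m ≤ g y - g' y := fun y => ciInf_le hbdd y
  have hmu : ∀ y, g y - g' y ≤ m + D := fun y => by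
    have : g y - g' y - D ≤ m := le_ciInf fun y' => by linarith [hD y y']
    linarith
  set I : α → ℝ := fun x => ∫ y, Real.exp (-η * c x y + η * g y) ∂ν with hI
  set J : α → ℝ := fun x => ∫ y, Real.exp (-η * c x y + η * g' y) ∂ν with hJ
  have iI := integrable_gibbs (ν := ν) hη hc h0 hg hK
  have iJ := integrable_gibbs (ν := ν) hη hc h0 hg' hK'
  have Ipos : ∀ x, 0 < I x := integral_gibbs_pos hη hc h0 hg hK
  have Jpos : ∀ x, 0 < J x := integral_gibbs_pos hη hc h0 hg' hK'
  set M := Real.exp (η * m) with hM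
  have hMpos : 0 < M := Real.exp_pos _
  have hsub : ∀ x, I x - M * J x = ∫ y, Real.exp (-η * c x y)
      * (Real.exp (η * g y) - M * Real.exp (η * g' y)) ∂ν := fun x => by
    simp only [hI, hJ]
    rw [← integral_const_mul, ← integral_sub (iI x) ((iJ x).const_mul M)]
    congr 1 with y
    rw [Real.exp_add, Real.exp_add]
    ring
  have hpos : ∀ y, 0 ≤ Real.exp (η * g y) - M * Real.exp (η * g' y) := fun y => by
    rw [hM, ← Real.exp_add, sub_nonneg, Real.exp_le_exp]
    nlinarith [hml y]
  have hsubi : ∀ x, Integrable (fun y => Real.exp (-η * c x y)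
      * (Real.exp (η * g y) - M * Real.exp (η * g' y))) ν := fun x => by
    refine ((iI x).sub ((iJ x).const_mul M)).congr (ae_of_all _ fun y => ?_)
    simp only [Pi.sub_apply]
    rw [Real.exp_add, Real.exp_add]
    ring
  -- both the numerators and the denominators change by a factor at most `exp η`
  have hcmp : Real.exp (-η) * (I x' - M * J x') ≤ I x - M * J x := by
    rw [hsub, hsub, ← integral_const_mul]
    refine integral_mono ((hsubi x').const_mul _) (hsubi x) fun y => ?_
    simp only
    rw [← mul_assoc, ← Real.exp_add]
    refine mul_le_mul_of_nonneg_right (Real.exp_le_exp.2 ?_) (hpos y)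
    nlinarith [h0 x' y, h1 x y]
  have hJcmp : J x ≤ Real.exp η * J x' := by
    simp only [hJ]
    rw [← integral_const_mul]
    refine integral_mono (iJ x) ((iJ x').const_mul _) fun y => ?_
    simp only
    rw [← Real.exp_add]
    refine Real.exp_le_exp.2 ?_
    nlinarith [h1 x' y, h0 x y]
  have hup : I x' ≤ M * Real.exp (η * D) * J x' := by
    simp only [hI, hJ]
    rw [← integral_const_mul]
    refine integral_mono (iI x') ((iJ x').const_mul _) fun y => ?_
    simp only
    rw [hM, ← Real.exp_add, ← Real.exp_add]
    refine Real.exp_le_exp.2 ?_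
    nlinarith [hmu y]
  have hlow' : 0 ≤ I x' - M * J x' := by
    rw [hsub]
    exact integral_nonneg fun y => mul_nonneg (Real.exp_pos _).le (hpos y)
  -- the ratios of partition functions, normalized by the lower bound `M` of `exp (η (g - g'))`
  set A := I x / (M * J x) with hA
  set A' := I x' / (M * J x') with hA'
  have hMJ : 0 < M * J x := mul_pos hMpos (Jpos x)
  have hMJ' : 0 < M * J x' := mul_pos hMpos (Jpos x')
  have hApos : 0 < A := div_pos (Ipos x) hMJ
  have hApos' : 0 < A' := div_pos (Ipos x') hMJ'
  have hAD : Real.log A' ≤ η * D := by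
    rw [← Real.log_exp (η * D)]
    refine Real.log_le_log hApos' ((div_le_iff₀ hMJ').2 ?_)
    linarith
  have hmain : δ * A' + (1 - δ) * 1 ≤ A := by
    have e1 : A - 1 = (I x - M * J x) / (M * J x) := by
      rw [hA, sub_div, div_self hMJ.ne']
    have e2 : A' - 1 = (I x' - M * J x') / (M * J x') := by
      rw [hA', sub_div, div_self hMJ'.ne']
    have : δ * (A' - 1) ≤ A - 1 := by
      rw [e1, e2, le_div_iff₀ hMJ]
      calc δ * ((I x' - M * J x') / (M * J x')) * (M * J x)
          ≤ δ * ((I x' - M * J x') / (M * J x')) * (M * (Real.exp η * J x')) := by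
            refine mul_le_mul_of_nonneg_left ?_ (mul_nonneg hδ0.le (div_nonneg hlow' hMJ'.le))
            exact mul_le_mul_of_nonneg_left hJcmp hMpos.le
        _ = δ * Real.exp η * (I x' - M * J x') := by
            have := (Jpos x').ne'
            field_simp
        _ = Real.exp (-η) * (I x' - M * J x') := by
            rw [hδ, ← Real.exp_add]; ring_nf
        _ ≤ _ := hcmp
    linarith
  have hlog : δ * Real.log A' ≤ Real.log A := by
    have h := Real.geom_mean_le_arith_mean2_weighted hδ0.le (sub_nonneg.2 hδ1) hApos'.le
      zero_le_one (by ring)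
    rw [Real.one_rpow, mul_one] at h
    rw [← Real.log_rpow hApos']
    exact Real.log_le_log (Real.rpow_pos_of_pos hApos' _) (h.trans hmain)
  have elog : Real.log A = Real.log (I x) - Real.log (J x) - η * m := by
    rw [hA, Real.log_div (Ipos x).ne' hMJ.ne', Real.log_mul hMpos.ne' (Jpos x).ne', hM,
      Real.log_exp]
    ring
  have elog' : Real.log A' = Real.log (I x') - Real.log (J x') - η * m := by
    rw [hA', Real.log_div (Ipos x').ne' hMJ'.ne', Real.log_mul hMpos.ne' (Jpos x').ne', hM,
      Real.log_exp]
    ring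
  have hfin : (softmin η ν c g x - softmin η ν c g' x)
      - (softmin η ν c g x' - softmin η ν c g' x') = (Real.log A' - Real.log A) / η := by
    rw [elog, elog']
    simp only [softmin, hI, hJ]
    field_simp
    ring
  rw [hfin, div_le_iff₀ hη]
  nlinarith [mul_le_mul_of_nonneg_left hAD (sub_nonneg.2 hδ1)]

lemma tendsto_softmin (hη : 0 < η) (hc : Measurable (Function.uncurry c))
    (h0 : ∀ x y, 0 ≤ c x y) {u : ℕ → β → ℝ} (hu : ∀ k, Measurable (u k))
    (hK : ∀ k y, |u k y| ≤ K) (hg : Measurable g) (hgK : ∀ y, |g y| ≤ K)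
    (hlim : ∀ y, Tendsto (fun k => u k y) atTop (𝓝 (g y))) (x : α) :
    Tendsto (fun k => softmin η ν c (u k) x) atTop (𝓝 (softmin η ν c g x)) := by
  have hcx : Measurable (c x) := hc.comp measurable_prodMk_left
  refine Tendsto.const_mul _ (Tendsto.log ?_ (integral_gibbs_pos hη hc h0 hg hgK x).ne')
  refine tendsto_integral_of_dominated_convergence (fun _ => Real.exp (η * K))
    (fun k => by have := hu k; fun_prop) (integrable_const _) (fun k => ae_of_all _ fun y => ?_)
    (ae_of_all _ fun y => ?_)
  · rw [Real.norm_eq_abs, Real.abs_exp]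
    exact Real.exp_le_exp.2 (by nlinarith [h0 x y, (abs_le.1 (hK k y)).2])
  · exact (Real.continuous_exp.tendsto _).comp (((hlim y).const_mul η).const_add _)

end Softmin

section Sinkhorn

variable {α β : Type*} [MeasurableSpace α] [MeasurableSpace β] {η : ℝ} {μ : Measure α}
  {ν : Measure β} [IsProbabilityMeasure μ] [IsProbabilityMeasure ν] {c : α → β → ℝ}

lemma abs_sub_integral_le {h : β → ℝ} (hh : Measurable h) {D : ℝ}
    (hD : ∀ y y', h y - h y' ≤ D) (y : β) : |h y - ∫ z, h z ∂ν| ≤ D := by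
  have hi : Integrable h ν := by
    refine Integrable.of_bound hh.aestronglyMeasurable (|h y| + D) (ae_of_all _ fun z => ?_)
    rw [Real.norm_eq_abs]
    have := hD y z
    have := hD z y
    rw [abs_le]
    constructor <;> linarith [neg_abs_le (h y), le_abs_self (h y)]
  have h1 : ∫ z, h z ∂ν ≤ h y + D := by
    calc _ ≤ ∫ _, (h y + D) ∂ν :=
          integral_mono hi (integrable_const _) fun z => by simpa using by linarith [hD z y]
      _ = _ := by simp
  have h2 : h y - D ≤ ∫ z, h z ∂ν := by
    calc _ = ∫ _, (h y - D) ∂ν := by simp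
      _ ≤ _ := integral_mono (integrable_const _) hi fun z => by simpa using by linarith [hD y z]
  rw [abs_le]
  constructor <;> linarith

lemma integral_sub_integral {h : β → ℝ} (hi : Integrable h ν) :
    ∫ y, (h y - ∫ z, h z ∂ν) ∂ν = 0 := by
  rw [integral_sub hi (integrable_const _)]
  simp

lemma sinkhornIter_spec (hη : 0 < η) (hc : Measurable (Function.uncurry c))
    (h0 : ∀ x y, 0 ≤ c x y) (h1 : ∀ x y, c x y ≤ 1) (k : ℕ) :
    Measurable (sinkhornIter η μ ν c k) ∧ (∀ y, |sinkhornIter η μ ν c k y| ≤ 1) ∧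
      (∀ y y', sinkhornIter η μ ν c k y - sinkhornIter η μ ν c k y' ≤ 1) ∧
      ∫ y, sinkhornIter η μ ν c k y ∂ν = 0 := by
  have hc' : Measurable (Function.uncurry fun y x => c x y) := hc.comp measurable_swap
  induction k with
  | zero => exact ⟨measurable_zero, by simp [sinkhornIter], by simp [sinkhornIter],
      by simp [sinkhornIter]⟩
  | succ k ih =>
    obtain ⟨hm, hb, -, -⟩ := ih
    have hf := measurable_softmin (η := η) (ν := ν) hc hm
    have hfb := abs_softmin_le (ν := ν) hη hc h0 h1 hm hb
    have hT := measurable_softmin (η := η) (ν := μ) hc' hf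
    have hTo := softmin_sub_le_one (ν := μ) hη hc' (fun y x => h0 x y) (fun y x => h1 x y) hf hfb
    have hTb := abs_softmin_le (ν := μ) hη hc' (fun y x => h0 x y) (fun y x => h1 x y) hf hfb
    refine ⟨hT.sub_const _, fun y => abs_sub_integral_le hT hTo y, fun y y' => ?_,
      integral_sub_integral ?_⟩
    · simp only [sinkhornIter]
      linarith [hTo y y']
    · exact Integrable.of_bound hT.aestronglyMeasurable _ (ae_of_all _ hTb)

/-- The oscillation of the increments of Sinkhorn's iteration decays geometrically; each step
applies two contracting soft-min transforms. -/
lemma sinkhornIter_contract (hη : 0 < η) (hc : Measurable (Function.uncurry c))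
    (h0 : ∀ x y, 0 ≤ c x y) (h1 : ∀ x y, c x y ≤ 1) (k : ℕ) (y y' : β) :
    (sinkhornIter η μ ν c (k + 1) y - sinkhornIter η μ ν c k y)
      - (sinkhornIter η μ ν c (k + 1) y' - sinkhornIter η μ ν c k y')
      ≤ ((1 - Real.exp (-2 * η)) * (1 - Real.exp (-2 * η))) ^ k := by
  have hc' : Measurable (Function.uncurry fun y x => c x y) := hc.comp measurable_swap
  have spec := sinkhornIter_spec (μ := μ) (ν := ν) hη hc h0 h1
  induction k generalizing y y' with
  | zero => simpa [sinkhornIter] using (spec 1).2.2.1 y y'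
  | succ k ih =>
    obtain ⟨hm, hb, -, -⟩ := spec k
    obtain ⟨hm', hb', -, -⟩ := spec (k + 1)
    have hf := measurable_softmin (η := η) (ν := ν) hc hm
    have hfb := abs_softmin_le (ν := ν) hη hc h0 h1 hm hb
    have hf' := measurable_softmin (η := η) (ν := ν) hc hm'
    have hfb' := abs_softmin_le (ν := ν) hη hc h0 h1 hm' hb'
    have step := softmin_contract (ν := μ) hη hc' (fun y x => h0 x y) (fun y x => h1 x y)
      hf' hfb' hf hfb (softmin_contract (ν := ν) hη hc h0 h1 hm' hb' hm hb ih) y y'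
    have e : ∀ j z, sinkhornIter η μ ν c (j + 1) z =
      softmin η μ (fun y x => c x y) (softmin η ν c (sinkhornIter η μ ν c j)) z -
        ∫ z, softmin η μ (fun y x => c x y) (softmin η ν c (sinkhornIter η μ ν c j)) z ∂ν :=
      fun j z => rfl
    rw [pow_succ', mul_assoc, e (k + 1) y, e k y, e (k + 1) y', e k y']
    linarith

lemma tendsto_sinkhornIter (hη : 0 < η) (hc : Measurable (Function.uncurry c))
    (h0 : ∀ x y, 0 ≤ c x y) (h1 : ∀ x y, c x y ≤ 1) (y : β) :
    Tendsto (fun k => sinkhornIter η μ ν c k y) atTop (𝓝 (sinkhornPotential η μ ν c y)) := by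
  have spec := sinkhornIter_spec (μ := μ) (ν := ν) hη hc h0 h1
  have hδ0 : 0 < Real.exp (-2 * η) := Real.exp_pos _
  have hδ1 : Real.exp (-2 * η) ≤ 1 := Real.exp_le_one_iff.2 (by linarith)
  refine (cauchySeq_of_le_geometric ((1 - Real.exp (-2 * η)) * (1 - Real.exp (-2 * η))) 1
    (by nlinarith) fun k => ?_).tendsto_limUnder
  rw [one_mul, dist_comm, Real.dist_eq]
  have hm : Measurable fun y => sinkhornIter η μ ν c (k + 1) y - sinkhornIter η μ ν c k y :=
    (spec (k + 1)).1.sub (spec k).1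
  have hi : ∀ k, Integrable (sinkhornIter η μ ν c k) ν := fun k =>
    Integrable.of_bound (spec k).1.aestronglyMeasurable 1 (ae_of_all _ (spec k).2.1)
  have h := abs_sub_integral_le (ν := ν) hm (sinkhornIter_contract hη hc h0 h1 k) y
  rwa [integral_sub (hi _) (hi _), (spec (k + 1)).2.2.2, (spec k).2.2.2, sub_zero, sub_zero] at h

lemma measurable_sinkhornPotential (hη : 0 < η) (hc : Measurable (Function.uncurry c))
    (h0 : ∀ x y, 0 ≤ c x y) (h1 : ∀ x y, c x y ≤ 1) : Measurable (sinkhornPotential η μ ν c) :=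
  measurable_of_tendsto_metrizable (fun k => (sinkhornIter_spec (μ := μ) hη hc h0 h1 k).1)
    (tendsto_pi_nhds.2 (tendsto_sinkhornIter hη hc h0 h1))

lemma abs_sinkhornPotential_le (hη : 0 < η) (hc : Measurable (Function.uncurry c))
    (h0 : ∀ x y, 0 ≤ c x y) (h1 : ∀ x y, c x y ≤ 1) (y : β) :
    |sinkhornPotential η μ ν c y| ≤ 1 :=
  le_of_tendsto (tendsto_sinkhornIter hη hc h0 h1 y).abs
    (Eventually.of_forall fun k => (sinkhornIter_spec hη hc h0 h1 k).2.1 y)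

lemma sinkhornPotential_sub_le_one (hη : 0 < η) (hc : Measurable (Function.uncurry c))
    (h0 : ∀ x y, 0 ≤ c x y) (h1 : ∀ x y, c x y ≤ 1) (y y' : β) :
    sinkhornPotential η μ ν c y - sinkhornPotential η μ ν c y' ≤ 1 :=
  le_of_tendsto ((tendsto_sinkhornIter hη hc h0 h1 y).sub (tendsto_sinkhornIter hη hc h0 h1 y'))
    (Eventually.of_forall fun k => (sinkhornIter_spec hη hc h0 h1 k).2.2.1 y y')

lemma integral_sinkhornPotential (hη : 0 < η) (hc : Measurable (Function.uncurry c))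
    (h0 : ∀ x y, 0 ≤ c x y) (h1 : ∀ x y, c x y ≤ 1) :
    ∫ y, sinkhornPotential η μ ν c y ∂ν = 0 := by
  have spec := sinkhornIter_spec (μ := μ) (ν := ν) hη hc h0 h1
  refine tendsto_nhds_unique (tendsto_integral_of_dominated_convergence (fun _ => (1 : ℝ))
    (fun k => (spec k).1.aestronglyMeasurable) (integrable_const _)
    (fun k => ae_of_all _ (spec k).2.1)
    (ae_of_all _ (tendsto_sinkhornIter hη hc h0 h1))) ?_
  simp [(spec _).2.2.2]

/-- The second Schrödinger equation for the limit of Sinkhorn's iteration; the first one is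
`integral_density_softmin`. -/
lemma integral_density_sinkhornPotential (hη : 0 < η) (hc : Measurable (Function.uncurry c))
    (h0 : ∀ x y, 0 ≤ c x y) (h1 : ∀ x y, c x y ≤ 1) (y : β) :
    ∫ x, Real.exp (-η * (c x y - softmin η ν c (sinkhornPotential η μ ν c) x
      - sinkhornPotential η μ ν c y)) ∂μ = 1 := by
  have hc' : Measurable (Function.uncurry fun y x => c x y) := hc.comp measurable_swap
  have spec := sinkhornIter_spec (μ := μ) (ν := ν) hη hc h0 h1
  set g := sinkhornPotential η μ ν c with hg
  have hgm : Measurable g := measurable_sinkhornPotential hη hc h0 h1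
  have hgb : ∀ y, |g y| ≤ 1 := abs_sinkhornPotential_le hη hc h0 h1
  set f := softmin η ν c g with hf
  have hfm : Measurable f := measurable_softmin hc hgm
  have hfb : ∀ x, |f x| ≤ 1 + 1 := abs_softmin_le hη hc h0 h1 hgm hgb
  set T := softmin η μ (fun y x => c x y) f with hT
  have hTm : Measurable T := measurable_softmin hc' hfm
  have limf : ∀ x, Tendsto (fun k => softmin η ν c (sinkhornIter η μ ν c k) x) atTop (𝓝 (f x)) :=
    tendsto_softmin hη hc h0 (fun k => (spec k).1) (fun k => (spec k).2.1) hgm hgb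
      (tendsto_sinkhornIter hη hc h0 h1)
  have mk : ∀ k, Measurable (softmin η ν c (sinkhornIter η μ ν c k)) := fun k =>
    measurable_softmin hc (spec k).1
  have bk : ∀ k x, |softmin η ν c (sinkhornIter η μ ν c k) x| ≤ 1 + 1 := fun k =>
    abs_softmin_le hη hc h0 h1 (spec k).1 (spec k).2.1
  have limT : ∀ y, Tendsto (fun k => softmin η μ (fun y x => c x y)
      (softmin η ν c (sinkhornIter η μ ν c k)) y) atTop (𝓝 (T y)) :=
    tendsto_softmin hη hc' (fun y x => h0 x y) mk bk hfm hfb limf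
  have limκ : Tendsto (fun k => ∫ z, softmin η μ (fun y x => c x y)
      (softmin η ν c (sinkhornIter η μ ν c k)) z ∂ν) atTop (𝓝 (∫ z, T z ∂ν)) := by
    refine tendsto_integral_of_dominated_convergence (fun _ => (1 + 1 + 1 : ℝ))
      (fun k => (measurable_softmin hc' (mk k)).aestronglyMeasurable) (integrable_const _)
      (fun k => ae_of_all _ fun z => ?_) (ae_of_all _ limT)
    exact abs_softmin_le hη hc' (fun y x => h0 x y) (fun y x => h1 x y) (mk k) (bk k) z
  set κ := ∫ z, T z ∂ν with hκ
  have hfix : ∀ y, g y = T y - κ := fun y =>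
    tendsto_nhds_unique ((tendsto_add_atTop_iff_nat 1).2 (tendsto_sinkhornIter hη hc h0 h1 y))
      ((limT y).sub limκ)
  have hval : ∀ y, ∫ x, Real.exp (-η * (c x y - f x - g y)) ∂μ = Real.exp (-η * κ) := by
    intro y
    have h := integral_density_softmin (ν := μ) hη hc' (fun y x => h0 x y) hfm hfb y
    have e : ∀ x, Real.exp (-η * (c x y - f x - g y))
        = Real.exp (-η * κ) * Real.exp (-η * (c x y - T y - f x)) := fun x => by
      rw [← Real.exp_add, hfix y]; ring_nf
    simp_rw [e]
    rw [integral_const_mul, h, mul_one]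
  -- integrating both Schrödinger equations shows that the recentring constant `κ` vanishes
  have hint : Integrable (Function.uncurry fun x y => Real.exp (-η * (c x y - f x - g y)))
      (μ.prod ν) := by
    have : Measurable fun z : α × β => c z.1 z.2 := hc
    refine Integrable.of_bound ?_ (Real.exp (η * 3)) (ae_of_all _ fun z => ?_)
    · simp only [Function.uncurry_def]
      exact Measurable.aestronglyMeasurable (by fun_prop)
    · simp only [Function.uncurry_def]
      rw [Real.norm_eq_abs, Real.abs_exp]
      refine Real.exp_le_exp.2 ?_
      nlinarith [h0 z.1 z.2, (abs_le.1 (hfb z.1)).2, (abs_le.1 (hgb z.2)).2]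
  have hswap := integral_integral_swap hint
  simp_rw [hval] at hswap
  have hone : ∀ x, ∫ y, Real.exp (-η * (c x y - f x - g y)) ∂ν = 1 :=
    integral_density_softmin hη hc h0 hgm hgb
  simp_rw [hone] at hswap
  simp only [integral_const, probReal_univ, smul_eq_mul, mul_one, one_mul] at hswap
  rw [hval y, ← hswap]

end Sinkhorn

/-! ### The empirical dual problem -/

/-- The uniform probability measure on `Fin n`. -/
noncomputable def unifMeasure (n : ℕ) : Measure (Fin n) := (n : ℝ≥0∞)⁻¹ • Measure.count

instance isProbabilityMeasure_unifMeasure (n : ℕ) [NeZero n] :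
    IsProbabilityMeasure (unifMeasure n) := ⟨by
  rw [unifMeasure, Measure.smul_apply, Measure.count_univ, smul_eq_mul]
  simp only [ENat.card_eq_coe_fintype_card, Fintype.card_fin]
  exact ENNReal.inv_mul_cancel (by simp [NeZero.ne n]) (by simp)⟩

lemma integral_unifMeasure {n : ℕ} {F : Type*} [NormedAddCommGroup F] [NormedSpace ℝ F]
    [CompleteSpace F] (f : Fin n → F) : ∫ i, f i ∂(unifMeasure n) = (n : ℝ)⁻¹ • ∑ i, f i := by
  rw [unifMeasure, integral_smul_measure, integral_count]
  simp

/-- The truncated squared distance. It agrees with the squared distance on a ball of radius `1/2`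
and takes values in `[0, 1]` everywhere. -/
noncomputable def truncCost {E : Type*} [NormedAddCommGroup E] (u v : E) : ℝ := min (‖u - v‖ ^ 2) 1

section TruncCost

variable {E : Type*} [NormedAddCommGroup E]

lemma truncCost_nonneg (u v : E) : 0 ≤ truncCost u v := le_min (by positivity) zero_le_one

lemma truncCost_le_one (u v : E) : truncCost u v ≤ 1 := min_le_right _ _

lemma truncCost_eq {u v : E} (hu : ‖u‖ ≤ 1 / 2) (hv : ‖v‖ ≤ 1 / 2) :
    truncCost u v = ‖u - v‖ ^ 2 := by
  have : ‖u - v‖ ≤ 1 := (norm_sub_le _ _).trans (by linarith)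
  exact min_eq_left (pow_le_one₀ (norm_nonneg _) this)

lemma continuous_truncCost : Continuous fun z : E × E => truncCost z.1 z.2 := by
  unfold truncCost
  fun_prop

end TruncCost

section Finite

variable {n : ℕ} {η : ℝ}

/-- The mean of the entries of a square matrix. -/
noncomputable def pairMean (h : Fin n → Fin n → ℝ) : ℝ := (n : ℝ)⁻¹ * ∑ i, ((n : ℝ)⁻¹ * ∑ j, h i j)

lemma pairMean_add (h k : Fin n → Fin n → ℝ) :
    pairMean (fun i j => h i j + k i j) = pairMean h + pairMean k := by
  simp only [pairMean, Finset.sum_add_distrib, mul_add]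

lemma pairMean_sub (h k : Fin n → Fin n → ℝ) :
    pairMean (fun i j => h i j - k i j) = pairMean h - pairMean k := by
  simp only [pairMean, Finset.sum_sub_distrib, mul_sub]

lemma pairMean_const_mul (t : ℝ) (h : Fin n → Fin n → ℝ) :
    pairMean (fun i j => t * h i j) = t * pairMean h := by
  simp only [pairMean, Finset.mul_sum]
  exact Finset.sum_congr rfl fun i _ => Finset.sum_congr rfl fun j _ => by ring

lemma pairMean_mul_left (h : Fin n → Fin n → ℝ) (α : Fin n → ℝ) :
    pairMean (fun i j => h i j * α i) = (n : ℝ)⁻¹ * ∑ i, ((n : ℝ)⁻¹ * ∑ j, h i j) * α i := by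
  simp only [pairMean, ← Finset.sum_mul, mul_assoc]

lemma pairMean_mul_right (h : Fin n → Fin n → ℝ) (β : Fin n → ℝ) :
    pairMean (fun i j => h i j * β j) = (n : ℝ)⁻¹ * ∑ j, ((n : ℝ)⁻¹ * ∑ i, h i j) * β j := by
  simp only [pairMean, Finset.mul_sum, Finset.sum_mul]
  rw [Finset.sum_comm]
  exact Finset.sum_congr rfl fun j _ => Finset.sum_congr rfl fun i _ => by ring

lemma pairMean_nonneg {h : Fin n → Fin n → ℝ} (hh : ∀ i j, 0 ≤ h i j) : 0 ≤ pairMean h :=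
  mul_nonneg (by positivity) (Finset.sum_nonneg fun i _ =>
    mul_nonneg (by positivity) (Finset.sum_nonneg fun j _ => hh i j))

lemma pairMean_mono {h k : Fin n → Fin n → ℝ} (hh : ∀ i j, h i j ≤ k i j) :
    pairMean h ≤ pairMean k := by
  have := pairMean_nonneg fun i j => sub_nonneg.2 (hh i j)
  rw [pairMean_sub] at this
  linarith

lemma eq_zero_of_pairMean_le_zero [NeZero n] {h : Fin n → Fin n → ℝ} (hh : ∀ i j, 0 ≤ h i j)
    (h0 : pairMean h ≤ 0) (i j : Fin n) : h i j = 0 := by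
  have hn : (0 : ℝ) < (n : ℝ)⁻¹ :=
    inv_pos.2 (Nat.cast_pos.2 (Nat.pos_of_ne_zero (NeZero.ne n)))
  have hnn' : ∀ i, 0 ≤ (n : ℝ)⁻¹ * ∑ j, h i j := fun i =>
    mul_nonneg hn.le (Finset.sum_nonneg fun j _ => hh i j)
  have hz := (mul_eq_zero.1 (le_antisymm h0 (pairMean_nonneg hh))).resolve_left hn.ne'
  have h1 := (Finset.sum_eq_zero_iff_of_nonneg fun i _ => hnn' i).1 hz i (Finset.mem_univ i)
  exact (Finset.sum_eq_zero_iff_of_nonneg fun j _ => hh i j).1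
    ((mul_eq_zero.1 h1).resolve_left hn.ne') j (Finset.mem_univ j)

/-- The dual objective of a finite problem with cost matrix `c` and uniform weights. -/
noncomputable def finiteDual (η : ℝ) (c : Fin n → Fin n → ℝ) (a b : Fin n → ℝ) : ℝ :=
  (n : ℝ)⁻¹ * ∑ i, a i + (n : ℝ)⁻¹ * ∑ j, b j -
    1 / η * pairMean fun i j => Real.exp (-η * (c i j - a i - b j)) - 1

/-- If `p` solves the finite Schrödinger system then the gap of the dual objective at `(a, b)` is
the mean of `p (exp θ - 1 - θ) / η` with `θ = η (a ⊕ b - a₀ ⊕ b₀)`. -/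
lemma finiteDual_gap (hη : 0 < η) {c : Fin n → Fin n → ℝ} {a₀ b₀ : Fin n → ℝ}
    (hrow : ∀ i, (n : ℝ)⁻¹ * ∑ j, Real.exp (-η * (c i j - a₀ i - b₀ j)) = 1)
    (hcol : ∀ j, (n : ℝ)⁻¹ * ∑ i, Real.exp (-η * (c i j - a₀ i - b₀ j)) = 1) (a b : Fin n → ℝ) :
    finiteDual η c a₀ b₀ - finiteDual η c a b =
      1 / η * pairMean fun i j => Real.exp (-η * (c i j - a₀ i - b₀ j)) *
        (Real.exp (η * ((a i - a₀ i) + (b j - b₀ j))) - 1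
          - η * ((a i - a₀ i) + (b j - b₀ j))) := by
  set p : Fin n → Fin n → ℝ := fun i j => Real.exp (-η * (c i j - a₀ i - b₀ j)) with hp
  have e1 : (fun i j => p i j * (Real.exp (η * ((a i - a₀ i) + (b j - b₀ j))) - 1
          - η * ((a i - a₀ i) + (b j - b₀ j))))
      = fun i j => ((Real.exp (-η * (c i j - a i - b j)) - 1) - (p i j - 1))
        - η * (p i j * (a i - a₀ i) + p i j * (b j - b₀ j)) := by
    ext i j
    have : Real.exp (-η * (c i j - a i - b j))
        = p i j * Real.exp (η * ((a i - a₀ i) + (b j - b₀ j))) := by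
      rw [hp, ← Real.exp_add]; ring_nf
    rw [this]
    ring
  rw [e1, pairMean_sub, pairMean_sub, pairMean_const_mul, pairMean_add,
    pairMean_mul_left p (fun i => a i - a₀ i), pairMean_mul_right p (fun j => b j - b₀ j),
    finiteDual, finiteDual]
  have hrow' : ∀ i, (n : ℝ)⁻¹ * ∑ j, p i j = 1 := hrow
  have hcol' : ∀ j, (n : ℝ)⁻¹ * ∑ i, p i j = 1 := hcol
  simp_rw [hrow', hcol', one_mul]
  simp only [Finset.sum_sub_distrib, hp]
  field_simp
  ring

lemma exp_sub_one_sub_nonneg (z : ℝ) : 0 ≤ Real.exp z - 1 - z := by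
  linarith [Real.add_one_le_exp z]

/-- Solutions of the finite Schrödinger system maximize the dual objective. -/
lemma finiteDual_le (hη : 0 < η) {c : Fin n → Fin n → ℝ} {a₀ b₀ : Fin n → ℝ}
    (hrow : ∀ i, (n : ℝ)⁻¹ * ∑ j, Real.exp (-η * (c i j - a₀ i - b₀ j)) = 1)
    (hcol : ∀ j, (n : ℝ)⁻¹ * ∑ i, Real.exp (-η * (c i j - a₀ i - b₀ j)) = 1) (a b : Fin n → ℝ) :
    finiteDual η c a b ≤ finiteDual η c a₀ b₀ := by
  rw [← sub_nonneg, finiteDual_gap hη hrow hcol]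
  exact mul_nonneg (by positivity) (pairMean_nonneg fun i j =>
    mul_nonneg (Real.exp_pos _).le (exp_sub_one_sub_nonneg _))

/-- The normalized maximizer of the finite dual objective is unique. -/
lemma finiteDual_unique [NeZero n] (hη : 0 < η) {c : Fin n → Fin n → ℝ} {a₀ b₀ : Fin n → ℝ}
    (hrow : ∀ i, (n : ℝ)⁻¹ * ∑ j, Real.exp (-η * (c i j - a₀ i - b₀ j)) = 1)
    (hcol : ∀ j, (n : ℝ)⁻¹ * ∑ i, Real.exp (-η * (c i j - a₀ i - b₀ j)) = 1)
    (hb₀ : ∑ j, b₀ j = 0) {a b : Fin n → ℝ} (hb : ∑ j, b j = 0)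
    (h : finiteDual η c a₀ b₀ ≤ finiteDual η c a b) : a = a₀ ∧ b = b₀ := by
  have hn : (0 : ℝ) < n := Nat.cast_pos.2 (Nat.pos_of_ne_zero (NeZero.ne n))
  have hgap := finiteDual_gap hη hrow hcol a b
  have hz := nonpos_of_mul_nonpos_right (hgap.symm.trans_le (sub_nonpos.2 h))
    (by positivity : 0 < 1 / η)
  have hθ : ∀ i j, (a i - a₀ i) + (b j - b₀ j) = 0 := fun i j => by
    have h2 := eq_zero_of_pairMean_le_zero (fun i j =>
      mul_nonneg (Real.exp_pos _).le (exp_sub_one_sub_nonneg _)) hz i j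
    have h3 := (mul_eq_zero.1 h2).resolve_left (Real.exp_pos _).ne'
    by_contra hne
    have := Real.add_one_lt_exp (x := η * ((a i - a₀ i) + (b j - b₀ j)))
      (mul_ne_zero hη.ne' hne)
    linarith
  have ha : ∀ i, a i = a₀ i := fun i => by
    have : ∑ j, ((a i - a₀ i) + (b j - b₀ j)) = 0 := Finset.sum_eq_zero fun j _ => hθ i j
    simp only [Finset.sum_add_distrib, Finset.sum_sub_distrib, hb, hb₀, sub_zero, add_zero,
      Finset.sum_const, Finset.card_univ, Fintype.card_fin, nsmul_eq_mul] at this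
    rw [← mul_sub] at this
    linarith [(mul_eq_zero.1 this).resolve_left hn.ne']
  refine ⟨funext ha, funext fun j => ?_⟩
  have := hθ 0 j
  rw [ha 0] at this
  linarith

/-- A Schrödinger equation determines one potential as the soft-min transform of the other. -/
lemma neg_log_mean_exp_eq [NeZero n] (hη : 0 < η) {r b : Fin n → ℝ} {a : ℝ}
    (h : (n : ℝ)⁻¹ * ∑ j, Real.exp (-η * (r j - a - b j)) = 1) :
    -(1 / η) * Real.log ((n : ℝ)⁻¹ * ∑ j, Real.exp (-η * r j + η * b j)) = a := by
  have e : ∀ j, Real.exp (-η * (r j - a - b j))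
      = Real.exp (η * a) * Real.exp (-η * r j + η * b j) := fun j => by
    rw [← Real.exp_add]; ring_nf
  simp_rw [e] at h
  rw [← Finset.mul_sum, mul_left_comm] at h
  have h2 : (n : ℝ)⁻¹ * ∑ j, Real.exp (-η * r j + η * b j) = Real.exp (-(η * a)) := by
    rw [Real.exp_neg]
    exact eq_inv_of_mul_eq_one_right h
  rw [h2, Real.log_exp]
  field_simp

end Finite

section Data

variable {d n : ℕ} {η : ℝ}

/-- The matrix of truncated costs between the data points `xᵢ` and `yⱼ`. -/
noncomputable def dataCost (x y : Fin n → EuclideanSpace ℝ (Fin d)) (i j : Fin n) : ℝ :=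
  truncCost (x i) (y j)

/-- The second Schrödinger potential of the data, as a vector indexed by the points `yⱼ`; it is
constructed by Sinkhorn's iteration and hence depends measurably on the data. -/
noncomputable def dataPotential (η : ℝ) (x y : Fin n → EuclideanSpace ℝ (Fin d)) : Fin n → ℝ :=
  sinkhornPotential η (unifMeasure n) (unifMeasure n) (dataCost x y)

/-- The first Schrödinger potential of the data, as a vector indexed by the points `xᵢ`. -/
noncomputable def dataPotentialLeft (η : ℝ) (x y : Fin n → EuclideanSpace ℝ (Fin d)) :
    Fin n → ℝ :=
  softmin η (unifMeasure n) (dataCost x y) (dataPotential η x y)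

variable (x y : Fin n → EuclideanSpace ℝ (Fin d))

lemma dataPotential_row [NeZero n] (hη : 0 < η) (i : Fin n) :
    (n : ℝ)⁻¹ * ∑ j, Real.exp (-η * (dataCost x y i j - dataPotentialLeft η x y i
      - dataPotential η x y j)) = 1 := by
  rw [← smul_eq_mul, ← integral_unifMeasure]
  exact integral_density_softmin (c := dataCost x y) hη (measurable_of_finite _)
    (fun _ _ => truncCost_nonneg _ _)
    (measurable_of_finite _)
    (abs_sinkhornPotential_le (c := dataCost x y) hη (measurable_of_finite _)
      (fun _ _ => truncCost_nonneg _ _) (fun _ _ => truncCost_le_one _ _)) i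

lemma dataPotential_col [NeZero n] (hη : 0 < η) (j : Fin n) :
    (n : ℝ)⁻¹ * ∑ i, Real.exp (-η * (dataCost x y i j - dataPotentialLeft η x y i
      - dataPotential η x y j)) = 1 := by
  rw [← smul_eq_mul, ← integral_unifMeasure]
  exact integral_density_sinkhornPotential (c := dataCost x y) hη (measurable_of_finite _)
    (fun _ _ => truncCost_nonneg _ _) (fun _ _ => truncCost_le_one _ _) j

lemma sum_dataPotential [NeZero n] (hη : 0 < η) : ∑ j, dataPotential η x y j = 0 := by
  have h : ∫ j, dataPotential η x y j ∂(unifMeasure n) = 0 :=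
    integral_sinkhornPotential (c := dataCost x y) hη (measurable_of_finite _)
      (fun _ _ => truncCost_nonneg _ _) (fun _ _ => truncCost_le_one _ _)
  rw [integral_unifMeasure, smul_eq_mul] at h
  exact (mul_eq_zero.1 h).resolve_left (by simp [NeZero.ne n])

lemma dataPotential_sub_le_one [NeZero n] (hη : 0 < η) (j k : Fin n) :
    dataPotential η x y j - dataPotential η x y k ≤ 1 :=
  sinkhornPotential_sub_le_one (c := dataCost x y) hη (measurable_of_finite _)
    (fun _ _ => truncCost_nonneg _ _) (fun _ _ => truncCost_le_one _ _) j k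

lemma measurable_dataCost (i j : Fin n) : Measurable
    fun z : (Fin n → EuclideanSpace ℝ (Fin d)) × (Fin n → EuclideanSpace ℝ (Fin d)) =>
      dataCost z.1 z.2 i j :=
  continuous_truncCost.measurable.comp
    (((measurable_pi_apply i).comp measurable_fst).prodMk
      ((measurable_pi_apply j).comp measurable_snd))

/-- Each Sinkhorn iterate is an explicit function of the data, so its limit is measurable. -/
lemma measurable_dataPotential [NeZero n] (hη : 0 < η) (j : Fin n) : Measurable
    fun z : (Fin n → EuclideanSpace ℝ (Fin d)) × (Fin n → EuclideanSpace ℝ (Fin d)) =>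
      dataPotential η z.1 z.2 j := by
  have hlim : ∀ z : (Fin n → EuclideanSpace ℝ (Fin d)) × (Fin n → EuclideanSpace ℝ (Fin d)),
      Filter.Tendsto (fun k => sinkhornIter η (unifMeasure n) (unifMeasure n)
        (dataCost z.1 z.2) k j) Filter.atTop (nhds (dataPotential η z.1 z.2 j)) := fun z =>
    tendsto_sinkhornIter (c := dataCost z.1 z.2) hη (measurable_of_finite _)
      (fun _ _ => truncCost_nonneg _ _) (fun _ _ => truncCost_le_one _ _) j
  refine measurable_of_tendsto_metrizable (fun k => ?_) (tendsto_pi_nhds.2 hlim)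
  clear hlim
  induction k generalizing j with
  | zero => exact measurable_const
  | succ k ih =>
    have hc := measurable_dataCost (d := d) (n := n)
    have hf : ∀ i, Measurable fun z : (Fin n → EuclideanSpace ℝ (Fin d)) ×
        (Fin n → EuclideanSpace ℝ (Fin d)) => softmin η (unifMeasure n) (dataCost z.1 z.2)
          (sinkhornIter η (unifMeasure n) (unifMeasure n) (dataCost z.1 z.2) k) i := fun i => by
      have := hc i
      simp only [softmin, integral_unifMeasure]
      fun_prop
    have hT : ∀ j, Measurable fun z : (Fin n → EuclideanSpace ℝ (Fin d)) ×
        (Fin n → EuclideanSpace ℝ (Fin d)) =>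
          softmin η (unifMeasure n) (fun j i => dataCost z.1 z.2 i j)
            (softmin η (unifMeasure n) (dataCost z.1 z.2)
              (sinkhornIter η (unifMeasure n) (unifMeasure n) (dataCost z.1 z.2) k)) j :=
        fun j => by
      have : ∀ i, Measurable fun z : (Fin n → EuclideanSpace ℝ (Fin d)) ×
        (Fin n → EuclideanSpace ℝ (Fin d)) => dataCost z.1 z.2 i j := fun i => hc i j
      rw [show (fun z : (Fin n → EuclideanSpace ℝ (Fin d)) ×
        (Fin n → EuclideanSpace ℝ (Fin d)) =>
          softmin η (unifMeasure n) (fun j i => dataCost z.1 z.2 i j)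
            (softmin η (unifMeasure n) (dataCost z.1 z.2)
              (sinkhornIter η (unifMeasure n) (unifMeasure n) (dataCost z.1 z.2) k)) j)
          = fun z => -(1 / η) * Real.log ((n : ℝ)⁻¹ * ∑ i, Real.exp (-η * dataCost z.1 z.2 i j
            + η * softmin η (unifMeasure n) (dataCost z.1 z.2)
              (sinkhornIter η (unifMeasure n) (unifMeasure n) (dataCost z.1 z.2) k) i)) from
        funext fun z => by rw [softmin, integral_unifMeasure, smul_eq_mul]]
      fun_prop
    simp only [sinkhornIter, integral_unifMeasure, smul_eq_mul]
    exact (hT j).sub ((Finset.measurable_sum _ fun i _ => hT i).const_mul _)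

lemma integral_empMeasure {F : Type*} [NormedAddCommGroup F] [NormedSpace ℝ F]
    [CompleteSpace F] (h : EuclideanSpace ℝ (Fin d) → F) :
    ∫ u, h u ∂(empMeasure x) = (n : ℝ)⁻¹ • ∑ i, h (x i) := by
  rw [empMeasure, integral_smul_measure,
    integral_finsetSum_measure fun i _ => integrable_dirac (by simp)]
  simp [integral_dirac]

lemma empMeasure_prod : (empMeasure x).prod (empMeasure y)
    = (n : ℝ≥0∞)⁻¹ • (n : ℝ≥0∞)⁻¹ • ∑ p : Fin n × Fin n, Measure.dirac (x p.1, y p.2) := by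
  rw [empMeasure, empMeasure, ← Measure.sum_fintype, ← Measure.sum_fintype, ← Measure.sum_fintype,
    Measure.prod_smul_left, Measure.prod_smul_right, Measure.prod_sum]
  simp_rw [Measure.dirac_prod_dirac]

lemma integral_empMeasure_prod (h : EuclideanSpace ℝ (Fin d) × EuclideanSpace ℝ (Fin d) → ℝ) :
    ∫ z, h z ∂((empMeasure x).prod (empMeasure y))
      = (n : ℝ)⁻¹ * ∑ i, ((n : ℝ)⁻¹ * ∑ j, h (x i, y j)) := by
  rw [empMeasure_prod, integral_smul_measure, integral_smul_measure,
    integral_finsetSum_measure fun i _ => integrable_dirac (by simp)]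
  simp only [integral_dirac, ENNReal.toReal_inv, ENNReal.toReal_natCast, smul_eq_mul]
  rw [Fintype.sum_prod_type, ← Finset.mul_sum]

lemma ae_empMeasure {p : EuclideanSpace ℝ (Fin d) → Prop} (h : ∀ i, p (x i)) :
    ∀ᵐ u ∂(empMeasure x), p u := by
  refine Measure.ae_smul_measure ?_ _
  rw [ae_finsetSum_measure_iff]
  intro i _
  rw [ae_dirac_eq]
  exact h i

lemma dualObjective_empMeasure (f g : EuclideanSpace ℝ (Fin d) → ℝ) :
    dualObjective η (empMeasure x) (empMeasure y) f g =
      finiteDual η (fun i j => ‖x i - y j‖ ^ 2) (fun i => f (x i)) (fun j => g (y j)) := by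
  rw [finiteDual, pairMean, dualObjective, integral_empMeasure, integral_empMeasure, integral_empMeasure_prod,
    smul_eq_mul, smul_eq_mul]

lemma memLp_top_empMeasure {f : EuclideanSpace ℝ (Fin d) → ℝ} (hf : Measurable f) :
    MemLp f ∞ (empMeasure x) := by
  refine memLp_top_of_bound hf.aestronglyMeasurable (∑ i, ‖f (x i)‖)
    (ae_empMeasure x fun i => ?_)
  exact Finset.single_le_sum (f := fun i => ‖f (x i)‖) (fun i _ => norm_nonneg _)
    (Finset.mem_univ i)

variable {x y}

/-- For data in the ball of radius `1/2`, the dual potentials of the empirical measures take on the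
data points the values produced by Sinkhorn's iteration. -/
lemma dualPotentials_empMeasure [NeZero n] (hη : 0 < η) (hx : ∀ i, ‖x i‖ ≤ 1 / 2)
    (hy : ∀ j, ‖y j‖ ≤ 1 / 2) :
    (∀ i, (dualPotentials η (empMeasure x) (empMeasure y)).1 (x i) = dataPotentialLeft η x y i) ∧
      ∀ j, (dualPotentials η (empMeasure x) (empMeasure y)).2 (y j) = dataPotential η x y j := by
  have hcost : ∀ i j, dataCost x y i j = ‖x i - y j‖ ^ 2 := fun i j => truncCost_eq (hx i) (hy j)
  have hrow := dataPotential_row x y hη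
  have hcol := dataPotential_col x y hη
  have hsum := sum_dataPotential x y hη
  simp_rw [hcost] at hrow hcol
  set a := dataPotentialLeft η x y
  set b := dataPotential η x y
  -- functions on the whole space which interpolate the vectors `a` and `b`
  let F : EuclideanSpace ℝ (Fin d) → ℝ := fun u =>
    -(1 / η) * Real.log ((n : ℝ)⁻¹ * ∑ j, Real.exp (-η * ‖u - y j‖ ^ 2 + η * b j))
  let G : EuclideanSpace ℝ (Fin d) → ℝ := fun v =>
    -(1 / η) * Real.log ((n : ℝ)⁻¹ * ∑ i, Real.exp (-η * ‖x i - v‖ ^ 2 + η * a i))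
  have hF : ∀ i, F (x i) = a i := fun i => neg_log_mean_exp_eq hη (hrow i)
  have hG : ∀ j, G (y j) = b j := fun j => by
    refine neg_log_mean_exp_eq hη ((congrArg _ (Finset.sum_congr rfl fun i _ => ?_)).trans
      (hcol j))
    congr 1
    ring
  have hex : ∃ fg, IsDualPotentials η (empMeasure x) (empMeasure y) fg := by
    refine ⟨(F, G), memLp_top_empMeasure x (by fun_prop), memLp_top_empMeasure y (by fun_prop),
      ?_, fun f g _ _ => ?_⟩
    · rw [integral_empMeasure]
      simp only [hG, hsum, smul_zero]
    · rw [dualObjective_empMeasure, dualObjective_empMeasure]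
      simp only [hF, hG]
      exact finiteDual_le hη hrow hcol (fun i => f (x i)) (fun j => g (y j))
  obtain ⟨-, -, h0, hmax⟩ := Classical.epsilon_spec hex
  have hmax' := hmax F G (memLp_top_empMeasure x (by fun_prop))
    (memLp_top_empMeasure y (by fun_prop))
  rw [dualObjective_empMeasure, dualObjective_empMeasure] at hmax'
  simp only [hF, hG] at hmax'
  rw [integral_empMeasure, smul_eq_mul] at h0
  have h0' := (mul_eq_zero.1 h0).resolve_left (by simp [NeZero.ne n])
  obtain ⟨h1, h2⟩ := finiteDual_unique hη hrow hcol hsum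
    (a := fun i => (dualPotentials η (empMeasure x) (empMeasure y)).1 (x i))
    (b := fun j => (dualPotentials η (empMeasure x) (empMeasure y)).2 (y j)) h0' hmax'
  exact ⟨fun i => congrFun h1 i, fun j => congrFun h2 j⟩

/-- The barycenter of the points `yⱼ` with weights proportional to
`exp(-η ‖u - yⱼ‖² + η bⱼ)`. -/
noncomputable def gibbsBarycenter (η : ℝ) (y : Fin n → EuclideanSpace ℝ (Fin d)) (b : Fin n → ℝ)
    (u : EuclideanSpace ℝ (Fin d)) : EuclideanSpace ℝ (Fin d) :=
  (∑ j, Real.exp (-η * ‖u - y j‖ ^ 2 + η * b j))⁻¹ •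
    ∑ j, Real.exp (-η * ‖u - y j‖ ^ 2 + η * b j) • y j

/-- The first potential drops out of the empirical regression function. -/
lemma empRegression_eq [NeZero n] (hη : 0 < η) (hx : ∀ i, ‖x i‖ ≤ 1 / 2)
    (hy : ∀ j, ‖y j‖ ≤ 1 / 2) (u : EuclideanSpace ℝ (Fin d)) :
    empRegression η x y u = gibbsBarycenter η y (dataPotential η x y) u := by
  obtain ⟨hL, hR⟩ := dualPotentials_empMeasure hη hx hy
  have hcost : ∀ i j, dataCost x y i j = ‖x i - y j‖ ^ 2 := fun i j => truncCost_eq (hx i) (hy j)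
  have hcol := dataPotential_col x y hη
  simp_rw [hcost] at hcol
  set b := dataPotential η x y
  have hright : ∀ j, empPotentialRight η x y (y j) = b j := fun j => by
    rw [empPotentialRight, canonicalExtension]
    simp_rw [hL]
    refine neg_log_mean_exp_eq hη (r := fun i => ‖y j - x i‖ ^ 2)
      ((congrArg _ (Finset.sum_congr rfl fun i _ => ?_)).trans (hcol j))
    rw [norm_sub_rev]
    congr 1
    ring
  set W := ∑ j, Real.exp (-η * ‖u - y j‖ ^ 2 + η * b j) with hW
  have hn : (0 : ℝ) < n := Nat.cast_pos.2 (Nat.pos_of_ne_zero (NeZero.ne n))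
  have hWpos : 0 < W := Finset.sum_pos (fun j _ => Real.exp_pos _) Finset.univ_nonempty
  have hleft : Real.exp (η * empPotentialLeft η x y u) = n * W⁻¹ := by
    rw [empPotentialLeft, canonicalExtension]
    simp_rw [hR]
    rw [← hW, ← mul_assoc, show η * -(1 / η) = -1 by field_simp, neg_one_mul, Real.exp_neg,
      Real.exp_log (by positivity), mul_inv, inv_inv]
  have hdens : ∀ j, empDensity η x y u (y j)
      = n * (W⁻¹ * Real.exp (-η * ‖u - y j‖ ^ 2 + η * b j)) := fun j => by
    rw [empDensity, hright, ← mul_assoc, ← hleft, ← Real.exp_add]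
    congr 1
    ring
  rw [empRegression, gibbsBarycenter, ← hW]
  simp_rw [hdens, mul_smul]
  rw [← Finset.smul_sum, ← Finset.smul_sum, smul_smul, inv_mul_cancel₀ hn.ne', one_smul]

end Data

/-! ### The population Schrödinger coupling -/

section Density

variable {α β : Type*} [MeasurableSpace β] {η : ℝ} {ν : Measure β} [IsProbabilityMeasure ν]

/-- A Gibbs density with mean `1`, whose exponent oscillates by at most `2η`, lies between
`exp(-2η)` and `exp(2η)`. -/
lemma density_bounds (hη : 0 < η) {r g : β → ℝ} {a : ℝ} (h0 : ∀ y, 0 ≤ r y) (h1 : ∀ y, r y ≤ 1)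
    (hg : ∀ y y', g y - g y' ≤ 1) (hi : ∫ y, Real.exp (-η * (r y - a - g y)) ∂ν = 1) (y : β) :
    Real.exp (-2 * η) ≤ Real.exp (-η * (r y - a - g y)) ∧
      Real.exp (-η * (r y - a - g y)) ≤ Real.exp (2 * η) := by
  have hint : Integrable (fun y => Real.exp (-η * (r y - a - g y))) ν := by
    by_contra h
    rw [integral_undef h] at hi
    exact zero_ne_one hi
  have hcmp : ∀ y y', Real.exp (-η * (r y - a - g y))
      ≤ Real.exp (2 * η) * Real.exp (-η * (r y' - a - g y')) := fun y y' => by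
    rw [← Real.exp_add]
    refine Real.exp_le_exp.2 ?_
    nlinarith [h0 y, h1 y', hg y y']
  constructor
  · have : ∫ y', Real.exp (-η * (r y' - a - g y')) ∂ν
        ≤ ∫ _, Real.exp (2 * η) * Real.exp (-η * (r y - a - g y)) ∂ν :=
      integral_mono hint (integrable_const _) fun y' => hcmp y' y
    rw [hi, integral_const, probReal_univ, one_smul] at this
    rw [show -2 * η = -(2 * η) by ring, Real.exp_neg]
    rwa [inv_le_iff_one_le_mul₀' (Real.exp_pos _)]
  · have : ∫ _, Real.exp (-η * (r y - a - g y)) ∂ν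
        ≤ ∫ y', Real.exp (2 * η) * Real.exp (-η * (r y' - a - g y')) ∂ν :=
      integral_mono (integrable_const _) (hint.const_mul _) fun y' => hcmp y y'
    rwa [integral_const_mul, hi, integral_const, probReal_univ, one_smul, mul_one] at this

end Density

section Population

variable {d : ℕ} {η : ℝ} {μ ν : Measure (EuclideanSpace ℝ (Fin d))}

/-- The second population potential `g⋆`, for the truncated cost. -/
noncomputable def popRight (η : ℝ) (μ ν : Measure (EuclideanSpace ℝ (Fin d))) :
    EuclideanSpace ℝ (Fin d) → ℝ :=
  sinkhornPotential η μ ν truncCost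

/-- The first population potential `f⋆`, for the truncated cost. -/
noncomputable def popLeft (η : ℝ) (μ ν : Measure (EuclideanSpace ℝ (Fin d))) :
    EuclideanSpace ℝ (Fin d) → ℝ :=
  softmin η ν truncCost (popRight η μ ν)

/-- The logarithm `-η (c - f⋆ - g⋆)` of the population density. -/
noncomputable def popLogDensity (η : ℝ) (μ ν : Measure (EuclideanSpace ℝ (Fin d)))
    (z : EuclideanSpace ℝ (Fin d) × EuclideanSpace ℝ (Fin d)) : ℝ :=
  -η * (truncCost z.1 z.2 - popLeft η μ ν z.1 - popRight η μ ν z.2)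

/-- The population density `p⋆ = exp(-η (c - f⋆ - g⋆))`. -/
noncomputable def popDensity (η : ℝ) (μ ν : Measure (EuclideanSpace ℝ (Fin d)))
    (u v : EuclideanSpace ℝ (Fin d)) : ℝ :=
  Real.exp (popLogDensity η μ ν (u, v))

lemma measurable_uncurry_truncCost :
    Measurable (Function.uncurry (truncCost (E := EuclideanSpace ℝ (Fin d)))) :=
  continuous_truncCost.measurable

lemma popDensity_nonneg (u v : EuclideanSpace ℝ (Fin d)) : 0 ≤ popDensity η μ ν u v :=
  (Real.exp_pos _).le

lemma ae_norm_le_of_mem_couplings (hμ : ∀ᵐ x ∂μ, ‖x‖ ≤ 1 / 2) (hν : ∀ᵐ y ∂ν, ‖y‖ ≤ 1 / 2)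
    {π : ProbabilityMeasure (EuclideanSpace ℝ (Fin d) × EuclideanSpace ℝ (Fin d))}
    (hπ : π ∈ couplings μ ν) :
    ∀ᵐ z ∂π.toMeasure, ‖z.1‖ ≤ 1 / 2 ∧ ‖z.2‖ ≤ 1 / 2 := by
  obtain ⟨h1, h2⟩ := hπ
  rw [← h1] at hμ
  rw [← h2] at hν
  filter_upwards [ae_of_ae_map measurable_fst.aemeasurable hμ,
    ae_of_ae_map measurable_snd.aemeasurable hν] with z hz1 hz2 using ⟨hz1, hz2⟩

variable [IsProbabilityMeasure μ] [IsProbabilityMeasure ν]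

lemma measurable_popRight (hη : 0 < η) : Measurable (popRight η μ ν) :=
  measurable_sinkhornPotential hη measurable_uncurry_truncCost truncCost_nonneg truncCost_le_one

lemma abs_popRight_le (hη : 0 < η) (v : EuclideanSpace ℝ (Fin d)) : |popRight η μ ν v| ≤ 1 :=
  abs_sinkhornPotential_le hη measurable_uncurry_truncCost truncCost_nonneg truncCost_le_one v

lemma popRight_sub_le_one (hη : 0 < η) (v v' : EuclideanSpace ℝ (Fin d)) :
    popRight η μ ν v - popRight η μ ν v' ≤ 1 :=
  sinkhornPotential_sub_le_one hη measurable_uncurry_truncCost truncCost_nonneg truncCost_le_one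
    v v'

lemma measurable_popLeft (hη : 0 < η) : Measurable (popLeft η μ ν) :=
  measurable_softmin measurable_uncurry_truncCost (measurable_popRight hη)

lemma abs_popLeft_le (hη : 0 < η) (u : EuclideanSpace ℝ (Fin d)) :
    |popLeft η μ ν u| ≤ 1 + 1 :=
  abs_softmin_le hη measurable_uncurry_truncCost truncCost_nonneg truncCost_le_one
    (measurable_popRight hη) (abs_popRight_le hη) u

lemma measurable_popLogDensity (hη : 0 < η) : Measurable (popLogDensity η μ ν) := by
  have h1 := measurable_popRight (μ := μ) (ν := ν) hη
  have h2 := measurable_popLeft (μ := μ) (ν := ν) hη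
  have h3 : Measurable fun z : EuclideanSpace ℝ (Fin d) × EuclideanSpace ℝ (Fin d) =>
    truncCost z.1 z.2 := continuous_truncCost.measurable
  unfold popLogDensity
  fun_prop

lemma measurable_popDensity (hη : 0 < η) :
    Measurable fun z : EuclideanSpace ℝ (Fin d) × EuclideanSpace ℝ (Fin d) =>
      popDensity η μ ν z.1 z.2 :=
  Real.measurable_exp.comp (measurable_popLogDensity hη)

lemma integral_popDensity_right (hη : 0 < η) (u : EuclideanSpace ℝ (Fin d)) :
    ∫ v, popDensity η μ ν u v ∂ν = 1 :=
  integral_density_softmin hη measurable_uncurry_truncCost truncCost_nonneg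
    (measurable_popRight hη) (abs_popRight_le hη) u

lemma integral_popDensity_left (hη : 0 < η) (v : EuclideanSpace ℝ (Fin d)) :
    ∫ u, popDensity η μ ν u v ∂μ = 1 :=
  integral_density_sinkhornPotential hη measurable_uncurry_truncCost truncCost_nonneg
    truncCost_le_one v

lemma popDensity_bounds (hη : 0 < η) (u v : EuclideanSpace ℝ (Fin d)) :
    Real.exp (-2 * η) ≤ popDensity η μ ν u v ∧ popDensity η μ ν u v ≤ Real.exp (2 * η) :=
  density_bounds hη (truncCost_nonneg u) (truncCost_le_one u) (popRight_sub_le_one hη)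
    (integral_popDensity_right hη u) v

lemma abs_popLogDensity_le (hη : 0 < η)
    (z : EuclideanSpace ℝ (Fin d) × EuclideanSpace ℝ (Fin d)) :
    |popLogDensity η μ ν z| ≤ 2 * η := by
  obtain ⟨h1, h2⟩ := popDensity_bounds (μ := μ) (ν := ν) hη z.1 z.2
  rw [popDensity, Real.exp_le_exp] at h1 h2
  exact abs_le.2 ⟨by linarith, h2⟩

lemma integrable_popLogDensity (hη : 0 < η)
    (ρ : Measure (EuclideanSpace ℝ (Fin d) × EuclideanSpace ℝ (Fin d))) [IsFiniteMeasure ρ] :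
    Integrable (popLogDensity η μ ν) ρ :=
  Integrable.of_bound (measurable_popLogDensity hη).aestronglyMeasurable _
    (ae_of_all _ (abs_popLogDensity_le hη))

lemma integrable_exp_popLogDensity (hη : 0 < η)
    (ρ : Measure (EuclideanSpace ℝ (Fin d) × EuclideanSpace ℝ (Fin d))) [IsFiniteMeasure ρ] :
    Integrable (fun z => Real.exp (popLogDensity η μ ν z)) ρ := by
  refine Integrable.of_bound (measurable_popDensity hη).aestronglyMeasurable (Real.exp (2 * η))
    (ae_of_all _ fun z => ?_)
  rw [Real.norm_eq_abs, Real.abs_exp]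
  exact (popDensity_bounds hη z.1 z.2).2

lemma integral_exp_popLogDensity (hη : 0 < η) :
    ∫ z, Real.exp (popLogDensity η μ ν z) ∂(μ.prod ν) = 1 := by
  rw [integral_prod _ (integrable_exp_popLogDensity hη _)]
  have h : ∀ u, ∫ v, Real.exp (popLogDensity η μ ν (u, v)) ∂ν = 1 := integral_popDensity_right hη
  simp [h]

/-- The conditional laws of the Schrödinger coupling: the kernel `p⋆(u, ·) ν`. -/
noncomputable def popKernel (η : ℝ) (μ ν : Measure (EuclideanSpace ℝ (Fin d)))
    [IsProbabilityMeasure ν] :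
    Kernel (EuclideanSpace ℝ (Fin d)) (EuclideanSpace ℝ (Fin d)) :=
  (Kernel.const _ ν).withDensity fun u v => ENNReal.ofReal (popDensity η μ ν u v)

lemma measurable_ofReal_popDensity (hη : 0 < η) :
    Measurable (Function.uncurry fun u v => ENNReal.ofReal (popDensity η μ ν u v)) :=
  (measurable_popDensity hη).ennreal_ofReal

lemma lintegral_popDensity_right (hη : 0 < η) (u : EuclideanSpace ℝ (Fin d)) :
    ∫⁻ v, ENNReal.ofReal (popDensity η μ ν u v) ∂ν = 1 := by
  rw [← ofReal_integral_eq_lintegral_ofReal _ (ae_of_all _ fun v => popDensity_nonneg _ _),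
    integral_popDensity_right hη, ENNReal.ofReal_one]
  by_contra h
  have := integral_popDensity_right (μ := μ) (ν := ν) hη u
  rw [integral_undef h] at this
  exact zero_ne_one this

lemma lintegral_popDensity_left (hη : 0 < η) (v : EuclideanSpace ℝ (Fin d)) :
    ∫⁻ u, ENNReal.ofReal (popDensity η μ ν u v) ∂μ = 1 := by
  rw [← ofReal_integral_eq_lintegral_ofReal _ (ae_of_all _ fun u => popDensity_nonneg _ _),
    integral_popDensity_left hη, ENNReal.ofReal_one]
  by_contra h
  have := integral_popDensity_left (μ := μ) (ν := ν) hη v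
  rw [integral_undef h] at this
  exact zero_ne_one this

lemma popKernel_apply (hη : 0 < η) (u : EuclideanSpace ℝ (Fin d)) :
    popKernel η μ ν u = ν.withDensity fun v => ENNReal.ofReal (popDensity η μ ν u v) := by
  rw [popKernel, Kernel.withDensity_apply _ (measurable_ofReal_popDensity hη), Kernel.const_apply]

lemma isMarkovKernel_popKernel (hη : 0 < η) : IsMarkovKernel (popKernel η μ ν) := ⟨fun u => ⟨by
  rw [popKernel_apply hη, withDensity_apply _ MeasurableSet.univ, Measure.restrict_univ,
    lintegral_popDensity_right hη]⟩⟩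

/-- The coupling with density `p⋆` with respect to `μ ⊗ ν`. -/
noncomputable def popCoupling (η : ℝ) (μ ν : Measure (EuclideanSpace ℝ (Fin d))) :
    Measure (EuclideanSpace ℝ (Fin d) × EuclideanSpace ℝ (Fin d)) :=
  (μ.prod ν).tilted (popLogDensity η μ ν)

lemma popCoupling_eq_withDensity (hη : 0 < η) : popCoupling η μ ν
    = (μ.prod ν).withDensity fun z => ENNReal.ofReal (popDensity η μ ν z.1 z.2) := by
  rw [popCoupling, Measure.tilted]
  simp_rw [integral_exp_popLogDensity hη, div_one]
  rfl

lemma popCoupling_eq_compProd (hη : 0 < η) : popCoupling η μ ν = μ ⊗ₘ popKernel η μ ν := by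
  have := isMarkovKernel_popKernel (μ := μ) (ν := ν) hη
  rw [popKernel] at this ⊢
  rw [Measure.compProd_withDensity (measurable_ofReal_popDensity hη), Measure.compProd_const,
    popCoupling_eq_withDensity hη]

lemma isProbabilityMeasure_popCoupling (hη : 0 < η) :
    IsProbabilityMeasure (popCoupling η μ ν) :=
  isProbabilityMeasure_tilted (integrable_exp_popLogDensity hη _)

lemma map_fst_popCoupling (hη : 0 < η) : (popCoupling η μ ν).map Prod.fst = μ := by
  have := isMarkovKernel_popKernel (μ := μ) (ν := ν) hη
  rw [popCoupling_eq_compProd hη]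
  exact Measure.fst_compProd μ _

lemma map_snd_popCoupling (hη : 0 < η) : (popCoupling η μ ν).map Prod.snd = ν := by
  ext s hs
  rw [Measure.map_apply measurable_snd hs, popCoupling_eq_withDensity hη,
    withDensity_apply _ (measurable_snd hs), ← Set.univ_prod, ← Measure.prod_restrict,
    Measure.restrict_univ,
    lintegral_prod_symm _ (measurable_popDensity hη).ennreal_ofReal.aemeasurable]
  simp_rw [lintegral_popDensity_left hη]
  simp

/-- On couplings with finite entropy the entropic cost is, up to a constant, the relative entropy
with respect to the coupling with density `p⋆`. -/
lemma entropicCost_eq (hη : 0 < η) (hμ : ∀ᵐ x ∂μ, ‖x‖ ≤ 1 / 2) (hν : ∀ᵐ y ∂ν, ‖y‖ ≤ 1 / 2)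
    {π : ProbabilityMeasure (EuclideanSpace ℝ (Fin d) × EuclideanSpace ℝ (Fin d))}
    (hπ : π ∈ couplings μ ν) (hkl : InformationTheory.klDiv π.toMeasure (μ.prod ν) ≠ ∞) :
    entropicCost η μ ν π = ENNReal.ofReal
        (1 / η * (InformationTheory.klDiv π.toMeasure (popCoupling η μ ν)).toReal
          + ((∫ u, popLeft η μ ν u ∂μ) + ∫ v, popRight η μ ν v ∂ν)) ∧
      InformationTheory.klDiv π.toMeasure (popCoupling η μ ν) ≠ ∞ ∧
      0 ≤ 1 / η * (InformationTheory.klDiv π.toMeasure (popCoupling η μ ν)).toReal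
          + ((∫ u, popLeft η μ ν u ∂μ) + ∫ v, popRight η μ ν v ∂ν) := by
  have := isProbabilityMeasure_popCoupling (μ := μ) (ν := ν) hη
  obtain ⟨hac, hllr⟩ := InformationTheory.klDiv_ne_top_iff.1 hkl
  have hac' : π.toMeasure ≪ popCoupling η μ ν :=
    hac.trans (absolutelyContinuous_tilted (integrable_exp_popLogDensity hη _))
  have hL := integrable_popLogDensity (μ := μ) (ν := ν) hη π.toMeasure
  have hllr' : Integrable (llr π.toMeasure (popCoupling η μ ν)) π.toMeasure :=
    integrable_llr_tilted_right hac hL hllr (integrable_exp_popLogDensity hη _)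
  have hkl' := InformationTheory.klDiv_ne_top hac' hllr'
  have key : (InformationTheory.klDiv π.toMeasure (popCoupling η μ ν)).toReal
      = (InformationTheory.klDiv π.toMeasure (μ.prod ν)).toReal
        - ∫ z, popLogDensity η μ ν z ∂π.toMeasure := by
    rw [InformationTheory.toReal_klDiv_of_measure_eq hac' (by simp),
      InformationTheory.toReal_klDiv_of_measure_eq hac (by simp), popCoupling,
      integral_llr_tilted_right hac hL (integrable_exp_popLogDensity hη _) hllr,
      integral_exp_popLogDensity hη, Real.log_one, add_zero]
  have hc : Measurable fun z : EuclideanSpace ℝ (Fin d) × EuclideanSpace ℝ (Fin d) =>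
    truncCost z.1 z.2 := continuous_truncCost.measurable
  have ic : Integrable (fun z : EuclideanSpace ℝ (Fin d) × EuclideanSpace ℝ (Fin d) =>
      truncCost z.1 z.2) π.toMeasure := by
    refine Integrable.of_bound hc.aestronglyMeasurable 1 (ae_of_all _ fun z => ?_)
    rw [Real.norm_eq_abs, abs_of_nonneg (truncCost_nonneg _ _)]
    exact truncCost_le_one _ _
  have hf := measurable_popLeft (μ := μ) (ν := ν) hη
  have hg := measurable_popRight (μ := μ) (ν := ν) hη
  have iF : Integrable (fun z : EuclideanSpace ℝ (Fin d) × EuclideanSpace ℝ (Fin d) =>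
      popLeft η μ ν z.1) π.toMeasure :=
    Integrable.of_bound (hf.comp measurable_fst).aestronglyMeasurable _
      (ae_of_all _ fun z => abs_popLeft_le hη z.1)
  have iG : Integrable (fun z : EuclideanSpace ℝ (Fin d) × EuclideanSpace ℝ (Fin d) =>
      popRight η μ ν z.2) π.toMeasure :=
    Integrable.of_bound (hg.comp measurable_snd).aestronglyMeasurable _
      (ae_of_all _ fun z => abs_popRight_le hη z.2)
  have eF : ∫ z, popLeft η μ ν z.1 ∂π.toMeasure = ∫ u, popLeft η μ ν u ∂μ := by
    refine Eq.trans ?_ (congrArg (fun ρ => ∫ u, popLeft η μ ν u ∂ρ) hπ.1)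
    rw [integral_map measurable_fst.aemeasurable hf.aestronglyMeasurable]
  have eG : ∫ z, popRight η μ ν z.2 ∂π.toMeasure = ∫ v, popRight η μ ν v ∂ν := by
    refine Eq.trans ?_ (congrArg (fun ρ => ∫ v, popRight η μ ν v ∂ρ) hπ.2)
    rw [integral_map measurable_snd.aemeasurable hg.aestronglyMeasurable]
  have eL : ∫ z, popLogDensity η μ ν z ∂π.toMeasure = -η * ((∫ z, truncCost z.1 z.2 ∂π.toMeasure)
      - (∫ u, popLeft η μ ν u ∂μ) - ∫ v, popRight η μ ν v ∂ν) := by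
    rw [← eF, ← eG]
    simp only [popLogDensity]
    rw [integral_const_mul, ← integral_sub ic iF, ← integral_sub (ic.sub' iF) iG]
  have ecost : ∫⁻ z, ‖z.1 - z.2‖ₑ ^ 2 ∂π.toMeasure
      = ENNReal.ofReal (∫ z, truncCost z.1 z.2 ∂π.toMeasure) := by
    rw [ofReal_integral_eq_lintegral_ofReal ic (ae_of_all _ fun z => truncCost_nonneg _ _)]
    refine lintegral_congr_ae ?_
    filter_upwards [ae_norm_le_of_mem_couplings hμ hν hπ] with z hz
    rw [truncCost_eq hz.1 hz.2, ENNReal.ofReal_pow (norm_nonneg _), ofReal_norm]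
  have hval : (∫ z, truncCost z.1 z.2 ∂π.toMeasure)
      + 1 / η * (InformationTheory.klDiv π.toMeasure (μ.prod ν)).toReal
      = 1 / η * (InformationTheory.klDiv π.toMeasure (popCoupling η μ ν)).toReal
          + ((∫ u, popLeft η μ ν u ∂μ) + ∫ v, popRight η μ ν v ∂ν) := by
    rw [key, eL]
    field_simp
    ring
  have hc0 : 0 ≤ ∫ z, truncCost z.1 z.2 ∂π.toMeasure :=
    integral_nonneg fun z => truncCost_nonneg _ _
  refine ⟨?_, hkl', ?_⟩
  · rw [entropicCost, ecost, ← hval, ENNReal.ofReal_add hc0 (by positivity),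
      ENNReal.ofReal_mul (by positivity), ENNReal.ofReal_toReal hkl]
  · rw [← hval]
    positivity

/-- The coupling with density `p⋆` has finite entropy because `log p⋆` is bounded. -/
lemma klDiv_popCoupling_ne_top (hη : 0 < η) :
    InformationTheory.klDiv (popCoupling η μ ν) (μ.prod ν) ≠ ∞ := by
  have := isProbabilityMeasure_popCoupling (μ := μ) (ν := ν) hη
  have hac : popCoupling η μ ν ≪ μ.prod ν := tilted_absolutelyContinuous _ _
  refine InformationTheory.klDiv_ne_top hac ?_
  refine (integrable_popLogDensity (μ := μ) (ν := ν) hη (popCoupling η μ ν)).congr ?_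
  have h := log_rnDeriv_tilted_left_self (μ := μ.prod ν)
    (integrable_exp_popLogDensity (μ := μ) (ν := ν) hη (μ.prod ν))
  filter_upwards [hac.ae_le h] with z hz
  rw [llr, popCoupling, hz, integral_exp_popLogDensity hη, Real.log_one, sub_zero]

/-- The Schrödinger coupling has density `p⋆`. -/
lemma schrodingerCoupling_eq (hη : 0 < η) (hμ : ∀ᵐ x ∂μ, ‖x‖ ≤ 1 / 2)
    (hν : ∀ᵐ y ∂ν, ‖y‖ ≤ 1 / 2) :
    (schrodingerCoupling η μ ν).toMeasure = popCoupling η μ ν := by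
  have := isProbabilityMeasure_popCoupling (μ := μ) (ν := ν) hη
  let π₀ : ProbabilityMeasure (EuclideanSpace ℝ (Fin d) × EuclideanSpace ℝ (Fin d)) :=
    ⟨popCoupling η μ ν, this⟩
  have hπ₀ : π₀ ∈ couplings μ ν := ⟨map_fst_popCoupling hη, map_snd_popCoupling hη⟩
  obtain ⟨c₀, -, p₀⟩ := entropicCost_eq hη hμ hν hπ₀ (klDiv_popCoupling_ne_top hη)
  have hz : InformationTheory.klDiv π₀.toMeasure (popCoupling η μ ν) = 0 :=
    InformationTheory.klDiv_self _
  rw [hz, ENNReal.toReal_zero, mul_zero, zero_add] at c₀ p₀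
  have hη' : ENNReal.ofReal (1 / η) ≠ 0 := by
    rw [Ne, ENNReal.ofReal_eq_zero, not_le]
    positivity
  have htop : ∀ π, InformationTheory.klDiv π.toMeasure (μ.prod ν) = ∞ →
      entropicCost η μ ν π = ∞ := fun π h => by
    rw [entropicCost, h, ENNReal.mul_top hη', add_top]
  have hex : ∃ π, IsSchrodingerCoupling η μ ν π := by
    refine ⟨π₀, hπ₀, fun π hπ => ?_⟩
    by_cases h : InformationTheory.klDiv π.toMeasure (μ.prod ν) = ∞
    · rw [htop π h]
      exact le_top
    · rw [(entropicCost_eq hη hμ hν hπ h).1, c₀]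
      refine ENNReal.ofReal_le_ofReal (le_add_of_nonneg_left (by positivity))
  obtain ⟨hmem, hmin⟩ := Classical.epsilon_spec hex
  change schrodingerCoupling η μ ν ∈ couplings μ ν at hmem
  have hle : entropicCost η μ ν (schrodingerCoupling η μ ν) ≤ entropicCost η μ ν π₀ := hmin π₀ hπ₀
  have hfin : InformationTheory.klDiv (schrodingerCoupling η μ ν).toMeasure (μ.prod ν) ≠ ∞ := by
    intro h
    rw [htop _ h, c₀] at hle
    exact ENNReal.ofReal_ne_top (top_le_iff.1 hle)
  obtain ⟨c₁, f₁, p₁⟩ := entropicCost_eq hη hμ hν hmem hfin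
  rw [c₀, c₁, ENNReal.ofReal_le_ofReal_iff p₀] at hle
  have h0 : (InformationTheory.klDiv (schrodingerCoupling η μ ν).toMeasure
      (popCoupling η μ ν)).toReal = 0 := by
    refine le_antisymm ?_ ENNReal.toReal_nonneg
    exact nonpos_of_mul_nonpos_right (by linarith) (by positivity : 0 < 1 / η)
  rw [ENNReal.toReal_eq_zero_iff] at h0
  exact InformationTheory.klDiv_eq_zero_iff.1 (h0.resolve_right f₁)

/-- The population entropic regression function, through the density `p⋆`. -/
noncomputable def popRegression (η : ℝ) (μ ν : Measure (EuclideanSpace ℝ (Fin d)))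
    (u : EuclideanSpace ℝ (Fin d)) : EuclideanSpace ℝ (Fin d) :=
  ∫ v, popDensity η μ ν u v • v ∂ν

lemma integral_popKernel (hη : 0 < η) (u : EuclideanSpace ℝ (Fin d)) :
    ∫ v, v ∂(popKernel η μ ν u) = popRegression η μ ν u := by
  have h0 := measurable_popDensity (μ := μ) (ν := ν) hη
  have hm : Measurable fun v => popDensity η μ ν u v := by
    have := h0.comp (measurable_prodMk_left (x := u))
    exact this
  rw [popKernel_apply hη, popRegression,
    integral_withDensity_eq_integral_toReal_smul hm.ennreal_ofReal
      (ae_of_all _ fun v => ENNReal.ofReal_lt_top)]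
  refine integral_congr_ae (ae_of_all _ fun v => ?_)
  simp only
  rw [ENNReal.toReal_ofReal (popDensity_nonneg _ _)]

lemma popKernel_ae_eq_condKernel (hη : 0 < η) (hμ : ∀ᵐ x ∂μ, ‖x‖ ≤ 1 / 2)
    (hν : ∀ᵐ y ∂ν, ‖y‖ ≤ 1 / 2) :
    ∀ᵐ u ∂μ, popKernel η μ ν u = (schrodingerCoupling η μ ν).toMeasure.condKernel u := by
  have := isMarkovKernel_popKernel (μ := μ) (ν := ν) hη
  have hπ := schrodingerCoupling_eq hη hμ hν
  have hfst : (schrodingerCoupling η μ ν).toMeasure.fst = μ := by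
    rw [hπ]
    exact map_fst_popCoupling hη
  have h := eq_condKernel_of_measure_eq_compProd (ρ := (schrodingerCoupling η μ ν).toMeasure)
    (popKernel η μ ν) (by rw [hfst, hπ, popCoupling_eq_compProd hη])
  rwa [hfst] at h

lemma regression_ae_eq (hη : 0 < η) (hμ : ∀ᵐ x ∂μ, ‖x‖ ≤ 1 / 2) (hν : ∀ᵐ y ∂ν, ‖y‖ ≤ 1 / 2) :
    regression η μ ν =ᵐ[μ] popRegression η μ ν := by
  filter_upwards [popKernel_ae_eq_condKernel hη hμ hν] with u hu
  rw [regression, ← hu, integral_popKernel hη]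

lemma measurable_popRegression (hη : 0 < η) : Measurable (popRegression η μ ν) := by
  have h0 := measurable_popDensity (μ := μ) (ν := ν) hη
  have h : StronglyMeasurable
      fun z : EuclideanSpace ℝ (Fin d) × EuclideanSpace ℝ (Fin d) =>
        popDensity η μ ν z.1 z.2 • z.2 :=
    h0.stronglyMeasurable.smul measurable_snd.stronglyMeasurable
  have h2 := h.integral_prod_right' (ν := ν)
  exact h2.measurable

end Population

/-! ### Stability of potentials and barycenters -/

section Stability

variable {n : ℕ} {η : ℝ}

/-- Quantitative strict monotonicity of the exponential. -/
lemma mul_sq_le_exp_sub_exp_mul {m s t : ℝ} (hs : m ≤ Real.exp s) (ht : m ≤ Real.exp t) :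
    m * (t - s) ^ 2 ≤ (Real.exp t - Real.exp s) * (t - s) := by
  have key : ∀ {s t : ℝ}, m ≤ Real.exp s → s ≤ t →
      m * (t - s) ^ 2 ≤ (Real.exp t - Real.exp s) * (t - s) := fun {s t} hs hst => by
    have h1 : Real.exp t = Real.exp s * Real.exp (t - s) := by rw [← Real.exp_add]; ring_nf
    have h2 := Real.add_one_le_exp (t - s)
    have h3 : Real.exp s * (t - s) ≤ Real.exp t - Real.exp s := by
      rw [h1]; nlinarith [Real.exp_pos s]
    have h4 : m * (t - s) ≤ Real.exp t - Real.exp s :=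
      (mul_le_mul_of_nonneg_right hs (by linarith)).trans h3
    nlinarith
  rcases le_total s t with h | h
  · exact key hs h
  · nlinarith [key ht h]

lemma abs_exp_sub_exp_le {s t M : ℝ} (hs : Real.exp s ≤ M) (ht : Real.exp t ≤ M) :
    |Real.exp t - Real.exp s| ≤ M * |t - s| := by
  have key : ∀ {s t : ℝ}, Real.exp t ≤ M → s ≤ t → |Real.exp t - Real.exp s| ≤ M * |t - s| :=
    fun {s t} ht hst => by
    rw [abs_of_nonneg (sub_nonneg.2 (Real.exp_le_exp.2 hst)), abs_of_nonneg (sub_nonneg.2 hst)]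
    have h1 : Real.exp s = Real.exp t * Real.exp (s - t) := by rw [← Real.exp_add]; ring_nf
    have h2 := Real.add_one_le_exp (s - t)
    have h3 : Real.exp t - Real.exp s ≤ Real.exp t * (t - s) := by
      rw [h1]; nlinarith [Real.exp_pos t]
    exact h3.trans (mul_le_mul_of_nonneg_right ht (by linarith))
  rcases le_total s t with h | h
  · exact key ht h
  · rw [abs_sub_comm, abs_sub_comm t]
    exact key hs h

/-- Strong concavity of the dual objective along bounded potentials: the distance of `b₀` to the
optimal `b`, after removal of the mean of `b - b₀`, is controlled by the residuals of `(a₀, b₀)`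
in the Schrödinger system. -/
lemma mean_sq_potential_le [NeZero n] (hη : 0 < η) {c : Fin n → Fin n → ℝ} {a b a₀ b₀ : Fin n → ℝ}
    (hrow : ∀ i, (n : ℝ)⁻¹ * ∑ j, Real.exp (-η * (c i j - a i - b j)) = 1)
    (hcol : ∀ j, (n : ℝ)⁻¹ * ∑ i, Real.exp (-η * (c i j - a i - b j)) = 1)
    {m : ℝ} (hm : 0 < m) (h : ∀ i j, m ≤ Real.exp (-η * (c i j - a i - b j)))
    (h₀ : ∀ i j, m ≤ Real.exp (-η * (c i j - a₀ i - b₀ j))) :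
    (n : ℝ)⁻¹ * ∑ j, (b j - b₀ j - (n : ℝ)⁻¹ * ∑ k, (b k - b₀ k)) ^ 2 ≤
      ((m * η) ^ 2)⁻¹ * (
        (n : ℝ)⁻¹ * ∑ i, ((n : ℝ)⁻¹ * ∑ j, (Real.exp (-η * (c i j - a₀ i - b₀ j)) - 1)) ^ 2 +
        (n : ℝ)⁻¹ * ∑ j, ((n : ℝ)⁻¹ * ∑ i, (Real.exp (-η * (c i j - a₀ i - b₀ j)) - 1)) ^ 2) := by
  have hn : (0 : ℝ) < n := Nat.cast_pos.2 (Nat.pos_of_ne_zero (NeZero.ne n))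
  set p : Fin n → Fin n → ℝ := fun i j => Real.exp (-η * (c i j - a i - b j)) with hp
  set p₀ : Fin n → Fin n → ℝ := fun i j => Real.exp (-η * (c i j - a₀ i - b₀ j)) with hp₀
  set κ := (n : ℝ)⁻¹ * ∑ k, (b k - b₀ k) with hκ
  set β : Fin n → ℝ := fun j => b j - b₀ j - κ with hβ
  set α : Fin n → ℝ := fun i => a i - a₀ i + κ with hα
  set r : Fin n → ℝ := fun i => (n : ℝ)⁻¹ * ∑ j, (p₀ i j - 1) with hr
  set s : Fin n → ℝ := fun j => (n : ℝ)⁻¹ * ∑ i, (p₀ i j - 1) with hs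
  have hβ0 : ∑ j, β j = 0 := by
    simp only [hβ, Finset.sum_sub_distrib (f := fun j => b j - b₀ j), Finset.sum_const,
      Finset.card_univ, Fintype.card_fin, nsmul_eq_mul, hκ]
    field_simp
    ring
  have hone : (n : ℝ)⁻¹ * ∑ _j : Fin n, (1 : ℝ) = 1 := by
    simp [hn.ne']
  have hr' : ∀ i, (n : ℝ)⁻¹ * ∑ j, (p i j - p₀ i j) = -r i := fun i => by
    have := hrow i
    simp only [hr, Finset.sum_sub_distrib, mul_sub, hone]
    linarith
  have hs' : ∀ j, (n : ℝ)⁻¹ * ∑ i, (p i j - p₀ i j) = -s j := fun j => by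
    have := hcol j
    simp only [hs, Finset.sum_sub_distrib, mul_sub, hone]
    linarith
  -- the monotonicity identity
  have hmono : pairMean (fun i j => (p i j - p₀ i j) * (α i + β j))
      = (n : ℝ)⁻¹ * ∑ i, -r i * α i + (n : ℝ)⁻¹ * ∑ j, -s j * β j := by
    simp_rw [mul_add]
    rw [pairMean_add, pairMean_mul_left (fun i j => p i j - p₀ i j) α,
      pairMean_mul_right (fun i j => p i j - p₀ i j) β]
    simp_rw [hr', hs']
  have hsq : pairMean (fun i j => (α i + β j) ^ 2)
      = (n : ℝ)⁻¹ * ∑ i, α i ^ 2 + (n : ℝ)⁻¹ * ∑ j, β j ^ 2 := by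
    have e : (fun i j => (α i + β j) ^ 2)
        = fun i j => (1 * α i ^ 2 + 1 * β j ^ 2) + (2 * α i) * β j := by
      ext i j; ring
    have e2 : pairMean (fun i j => (2 * α i) * β j) = 0 := by
      simp only [pairMean, ← Finset.mul_sum, hβ0, mul_zero, Finset.sum_const_zero]
    rw [e, pairMean_add, pairMean_add, e2, add_zero,
      pairMean_mul_left (fun _ _ => 1) (fun i => α i ^ 2),
      pairMean_mul_right (fun _ _ => 1) (fun j => β j ^ 2)]
    simp_rw [hone, one_mul]
  have hlow : m * η * pairMean (fun i j => (α i + β j) ^ 2)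
      ≤ pairMean (fun i j => (p i j - p₀ i j) * (α i + β j)) := by
    rw [← pairMean_const_mul]
    refine pairMean_mono fun i j => ?_
    have := mul_sq_le_exp_sub_exp_mul (h₀ i j) (h i j)
    have e : -η * (c i j - a i - b j) - -η * (c i j - a₀ i - b₀ j) = η * (α i + β j) := by
      simp only [hα, hβ]; ring
    rw [e] at this
    change _ ≤ (p i j - p₀ i j) * _ at this
    have h2 : η * (m * η * (α i + β j) ^ 2) ≤ η * ((p i j - p₀ i j) * (α i + β j)) := by
      linarith
    exact le_of_mul_le_mul_left h2 hη
  have hmη : 0 < m * η := mul_pos hm hη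
  have hyoung : ∀ f g : Fin n → ℝ, (n : ℝ)⁻¹ * ∑ i, -f i * g i
      ≤ (2 * (m * η))⁻¹ * ((n : ℝ)⁻¹ * ∑ i, f i ^ 2)
        + m * η / 2 * ((n : ℝ)⁻¹ * ∑ i, g i ^ 2) := fun f g => by
    rw [mul_left_comm, mul_left_comm (m * η / 2), ← mul_add]
    refine mul_le_mul_of_nonneg_left ?_ (by positivity)
    rw [Finset.mul_sum, Finset.mul_sum, ← Finset.sum_add_distrib]
    refine Finset.sum_le_sum fun i _ => ?_
    have : 0 ≤ (2 * (m * η))⁻¹ * (f i + m * η * g i) ^ 2 := by positivity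
    have e : (2 * (m * η))⁻¹ * (f i + m * η * g i) ^ 2
        = (2 * (m * η))⁻¹ * f i ^ 2 + m * η / 2 * g i ^ 2 + f i * g i := by
      field_simp
      ring
    linarith
  have h1 := hyoung r α
  have h2 := hyoung s β
  have hα0 : 0 ≤ (n : ℝ)⁻¹ * ∑ i, α i ^ 2 := by positivity
  rw [hsq, hmono] at hlow
  set A := (n : ℝ)⁻¹ * ∑ i, α i ^ 2
  set B := (n : ℝ)⁻¹ * ∑ j, β j ^ 2
  set R := (n : ℝ)⁻¹ * ∑ i, r i ^ 2
  set S := (n : ℝ)⁻¹ * ∑ j, s j ^ 2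
  have h3 : m * η / 2 * B ≤ (2 * (m * η))⁻¹ * (R + S) := by
    have := mul_nonneg hmη.le hα0
    linarith
  rw [inv_mul_eq_div, le_div_iff₀ (by positivity)] at h3 ⊢
  linarith

end Stability

section Barycenter

variable {E : Type*} [NormedAddCommGroup E] [NormedSpace ℝ E] {ι : Type*} [Fintype ι] {w : ι → ℝ}
  {y : ι → E}

lemma norm_weighted_mean_le (hw : ∀ j, 0 ≤ w j) {ρ : ℝ} (hρ : 0 ≤ ρ) (hy : ∀ j, ‖y j‖ ≤ ρ) :
    ‖(∑ j, w j)⁻¹ • ∑ j, w j • y j‖ ≤ ρ := by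
  have hW : 0 ≤ ∑ j, w j := Finset.sum_nonneg fun j _ => hw j
  rw [norm_smul, norm_inv, Real.norm_of_nonneg hW, inv_mul_eq_div]
  refine div_le_of_le_mul₀ hW hρ ?_
  rw [Finset.mul_sum]
  refine (norm_sum_le _ _).trans (Finset.sum_le_sum fun j _ => ?_)
  rw [norm_smul, Real.norm_of_nonneg (hw j), mul_comm]
  exact mul_le_mul_of_nonneg_right (hy j) (hw j)

lemma weighted_mean_sub (hW : ∑ j, w j ≠ 0) (T : E) :
    (∑ j, w j)⁻¹ • ∑ j, w j • y j - T = (∑ j, w j)⁻¹ • ∑ j, w j • (y j - T) := by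
  simp_rw [smul_sub]
  rw [Finset.sum_sub_distrib, smul_sub, ← Finset.sum_smul, smul_smul, inv_mul_cancel₀ hW, one_smul]

/-- Stability of a weighted mean of points in the ball of radius `1/2` with respect to the
weights. -/
lemma norm_weighted_mean_sub_le [Nonempty ι] {w' : ι → ℝ} (hw : ∀ j, 0 < w j)
    (hw' : ∀ j, 0 < w' j) (hy : ∀ j, ‖y j‖ ≤ 1 / 2) :
    ‖(∑ j, w' j)⁻¹ • ∑ j, w' j • y j - (∑ j, w j)⁻¹ • ∑ j, w j • y j‖
      ≤ (∑ j, w' j)⁻¹ * ∑ j, |w' j - w j| := by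
  have hW : 0 < ∑ j, w j := Finset.sum_pos (fun j _ => hw j) Finset.univ_nonempty
  have hW' : 0 < ∑ j, w' j := Finset.sum_pos (fun j _ => hw' j) Finset.univ_nonempty
  set T := (∑ j, w j)⁻¹ • ∑ j, w j • y j with hT
  have hTn : ‖T‖ ≤ 1 / 2 := norm_weighted_mean_le (fun j => (hw j).le) (by norm_num) hy
  have h0 : ∑ j, w j • (y j - T) = 0 := by
    have := weighted_mean_sub (y := y) hW.ne' T
    rw [← hT, sub_self] at this
    exact (smul_eq_zero.1 this.symm).resolve_left (inv_ne_zero hW.ne')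
  have h1 : ∑ j, w' j • (y j - T) = ∑ j, (w' j - w j) • (y j - T) := by
    simp_rw [sub_smul]
    rw [Finset.sum_sub_distrib, h0, sub_zero]
  rw [weighted_mean_sub hW'.ne', h1, norm_smul, norm_inv, Real.norm_of_nonneg hW'.le]
  refine mul_le_mul_of_nonneg_left ((norm_sum_le _ _).trans (Finset.sum_le_sum fun j _ => ?_))
    (by positivity)
  rw [norm_smul, Real.norm_eq_abs]
  refine mul_le_of_le_one_right (abs_nonneg _) ((norm_sub_le _ _).trans ?_)
  linarith [hy j]

end Barycenter

section Data

variable {d n : ℕ} {η : ℝ}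

lemma gibbsBarycenter_sub_const (y : Fin n → EuclideanSpace ℝ (Fin d)) (b : Fin n → ℝ) (κ : ℝ)
    (u : EuclideanSpace ℝ (Fin d)) :
    gibbsBarycenter η y (fun j => b j - κ) u = gibbsBarycenter η y b u := by
  have e : ∀ j, Real.exp (-η * ‖u - y j‖ ^ 2 + η * (b j - κ))
      = Real.exp (-(η * κ)) * Real.exp (-η * ‖u - y j‖ ^ 2 + η * b j) := fun j => by
    rw [← Real.exp_add]; ring_nf
  rw [gibbsBarycenter, gibbsBarycenter]
  simp_rw [e, mul_smul]
  rw [← Finset.mul_sum, ← Finset.smul_sum, mul_inv, mul_smul, smul_comm (∑ j, _)⁻¹, smul_smul,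
    inv_mul_cancel₀ (Real.exp_pos _).ne', one_smul]

lemma norm_sub_sq_le_one {E : Type*} [NormedAddCommGroup E] {u v : E} (hu : ‖u‖ ≤ 1 / 2)
    (hv : ‖v‖ ≤ 1 / 2) : ‖u - v‖ ^ 2 ≤ 1 := by
  rw [← truncCost_eq hu hv]
  exact truncCost_le_one u v

/-- The Gibbs barycenter is Lipschitz in the potential, modulo constants. -/
lemma norm_gibbsBarycenter_sub_le [NeZero n] (hη : 0 < η)
    {y : Fin n → EuclideanSpace ℝ (Fin d)} (hy : ∀ j, ‖y j‖ ≤ 1 / 2) {b b₀ : Fin n → ℝ}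
    (hb : ∀ j k, b j - b k ≤ 1) (hb₀ : ∀ j k, b₀ j - b₀ k ≤ 1)
    {u : EuclideanSpace ℝ (Fin d)} (hu : ‖u‖ ≤ 1 / 2) :
    ‖gibbsBarycenter η y b u - gibbsBarycenter η y b₀ u‖ ≤
      η * Real.exp (4 * η) *
        ((n : ℝ)⁻¹ * ∑ j, |b j - b₀ j - (n : ℝ)⁻¹ * ∑ k, (b k - b₀ k)|) := by
  have hn : (0 : ℝ) < n := Nat.cast_pos.2 (Nat.pos_of_ne_zero (NeZero.ne n))
  set κ := (n : ℝ)⁻¹ * ∑ k, (b k - b₀ k) with hκ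
  have hβ : ∀ j, |b j - b₀ j - κ| ≤ 2 := fun j => by
    have h := abs_sub_integral_le (ν := unifMeasure n) (h := fun j => b j - b₀ j)
      (measurable_of_finite _) (D := 2) (fun j k => by linarith [hb j k, hb₀ k j]) j
    rwa [integral_unifMeasure, smul_eq_mul] at h
  rw [← gibbsBarycenter_sub_const y b κ]
  set w' : Fin n → ℝ := fun j => Real.exp (-η * ‖u - y j‖ ^ 2 + η * (b j - κ)) with hw'
  set w : Fin n → ℝ := fun j => Real.exp (-η * ‖u - y j‖ ^ 2 + η * b₀ j) with hw
  have hW' : 0 < ∑ j, w' j := Finset.sum_pos (fun j _ => Real.exp_pos _) Finset.univ_nonempty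
  refine (norm_weighted_mean_sub_le (w := w) (w' := w') (fun j => Real.exp_pos _)
    (fun j => Real.exp_pos _) hy).trans ?_
  -- every weight is at most `exp(2η)` times the mean weight
  have hmax : ∀ j, w' j ≤ Real.exp (2 * η) * ((n : ℝ)⁻¹ * ∑ k, w' k) := fun j => by
    have : ∑ _k : Fin n, w' j ≤ ∑ k, Real.exp (2 * η) * w' k :=
      Finset.sum_le_sum fun k _ => by
        rw [hw', ← Real.exp_add]
        refine Real.exp_le_exp.2 ?_
        nlinarith [hb j k, norm_sub_sq_le_one hu (hy k), sq_nonneg ‖u - y j‖]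
    rw [Finset.sum_const, Finset.card_univ, Fintype.card_fin, nsmul_eq_mul, ← Finset.mul_sum]
      at this
    rw [mul_left_comm, inv_mul_eq_div, le_div_iff₀ hn]
    linarith
  have hdiff : ∀ j, |w' j - w j|
      ≤ Real.exp (4 * η) * ((n : ℝ)⁻¹ * ∑ k, w' k) * (η * |b j - b₀ j - κ|) := fun j => by
    have h1 : w' j ≤ Real.exp (4 * η) * ((n : ℝ)⁻¹ * ∑ k, w' k) :=
      (hmax j).trans (mul_le_mul_of_nonneg_right (Real.exp_le_exp.2 (by linarith))
        (by positivity))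
    have h2 : w j ≤ Real.exp (4 * η) * ((n : ℝ)⁻¹ * ∑ k, w' k) := by
      have : w j ≤ Real.exp (2 * η) * w' j := by
        rw [hw, hw', ← Real.exp_add]
        refine Real.exp_le_exp.2 ?_
        nlinarith [(abs_le.1 (hβ j)).1]
      refine (this.trans (mul_le_mul_of_nonneg_left (hmax j) (Real.exp_pos _).le)).trans_eq ?_
      rw [← mul_assoc, ← Real.exp_add]
      ring_nf
    refine (abs_exp_sub_exp_le h2 h1).trans_eq ?_
    rw [show -η * ‖u - y j‖ ^ 2 + η * (b j - κ) - (-η * ‖u - y j‖ ^ 2 + η * b₀ j)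
      = η * (b j - b₀ j - κ) by ring, abs_mul, abs_of_pos hη]
  calc (∑ j, w' j)⁻¹ * ∑ j, |w' j - w j|
      ≤ (∑ j, w' j)⁻¹ * ∑ j, Real.exp (4 * η) * ((n : ℝ)⁻¹ * ∑ k, w' k)
          * (η * |b j - b₀ j - κ|) :=
        mul_le_mul_of_nonneg_left (Finset.sum_le_sum fun j _ => hdiff j) (by positivity)
    _ = _ := by
        rw [← Finset.mul_sum, ← Finset.mul_sum]
        field_simp

variable {μ ν : Measure (EuclideanSpace ℝ (Fin d))} [IsProbabilityMeasure μ]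
  [IsProbabilityMeasure ν]

lemma norm_popRegression_le (hη : 0 < η) (hν : ∀ᵐ y ∂ν, ‖y‖ ≤ 1 / 2)
    (u : EuclideanSpace ℝ (Fin d)) : ‖popRegression η μ ν u‖ ≤ 1 / 2 := by
  have hi : Integrable (popDensity η μ ν u) ν := by
    by_contra h
    have h1 := integral_popDensity_right (μ := μ) (ν := ν) hη u
    rw [integral_undef h] at h1
    exact zero_ne_one h1
  calc ‖popRegression η μ ν u‖ ≤ ∫ v, popDensity η μ ν u v * (1 / 2) ∂ν := by
        refine norm_integral_le_of_norm_le (hi.mul_const _) ?_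
        filter_upwards [hν] with v hv
        rw [norm_smul, Real.norm_of_nonneg (popDensity_nonneg u v)]
        exact mul_le_mul_of_nonneg_left hv (popDensity_nonneg u v)
    _ = 1 / 2 := by rw [integral_mul_const, integral_popDensity_right hη, one_mul]

/-- With the population potential in place of the empirical one, the error of the Gibbs barycenter
is a mean of independent centred vectors, up to a bounded factor. -/
lemma norm_gibbsBarycenter_sub_popRegression_le [NeZero n] (hη : 0 < η)
    {y : Fin n → EuclideanSpace ℝ (Fin d)} (hy : ∀ j, ‖y j‖ ≤ 1 / 2)
    {u : EuclideanSpace ℝ (Fin d)} (hu : ‖u‖ ≤ 1 / 2) :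
    ‖gibbsBarycenter η y (fun j => popRight η μ ν (y j)) u - popRegression η μ ν u‖ ≤
      Real.exp (2 * η) *
        ((n : ℝ)⁻¹ * ‖∑ j, popDensity η μ ν u (y j) • (y j - popRegression η μ ν u)‖) := by
  have hn : (0 : ℝ) < n := Nat.cast_pos.2 (Nat.pos_of_ne_zero (NeZero.ne n))
  have e : gibbsBarycenter η y (fun j => popRight η μ ν (y j)) u
      = (∑ j, popDensity η μ ν u (y j))⁻¹ • ∑ j, popDensity η μ ν u (y j) • y j := by
    rw [← gibbsBarycenter_sub_const y _ (-popLeft η μ ν u), gibbsBarycenter]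
    have : ∀ j, Real.exp (-η * ‖u - y j‖ ^ 2 + η * (popRight η μ ν (y j) - -popLeft η μ ν u))
        = popDensity η μ ν u (y j) := fun j => by
      rw [popDensity, popLogDensity, truncCost_eq hu (hy j)]
      ring_nf
    simp_rw [this]
  have hlow : n * Real.exp (-(2 * η)) ≤ ∑ j, popDensity η μ ν u (y j) := by
    have : ∑ _j : Fin n, Real.exp (-2 * η) ≤ ∑ j, popDensity η μ ν u (y j) :=
      Finset.sum_le_sum fun j _ => (popDensity_bounds hη u (y j)).1
    rw [Finset.sum_const, Finset.card_univ, Fintype.card_fin, nsmul_eq_mul] at this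
    rwa [← neg_mul]
  have hpos : 0 < n * Real.exp (-(2 * η)) := by positivity
  rw [e, weighted_mean_sub (hpos.trans_le hlow).ne', norm_smul, norm_inv,
    Real.norm_of_nonneg (hpos.le.trans hlow), ← mul_assoc]
  refine mul_le_mul_of_nonneg_right ?_ (norm_nonneg _)
  calc (∑ j, popDensity η μ ν u (y j))⁻¹ ≤ (n * Real.exp (-(2 * η)))⁻¹ :=
        inv_anti₀ hpos hlow
    _ = _ := by rw [mul_inv, Real.exp_neg, inv_inv, mul_comm]

/-- The deterministic error bound: on data in the ball of radius `1/2`, the squared error at a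
point of the ball is controlled by three kinds of normalized sums of centred variables. -/
lemma sq_norm_gibbsBarycenter_sub_popRegression_le [NeZero n] (hη : 0 < η)
    {x y : Fin n → EuclideanSpace ℝ (Fin d)} (hy : ∀ j, ‖y j‖ ≤ 1 / 2)
    {u : EuclideanSpace ℝ (Fin d)} (hu : ‖u‖ ≤ 1 / 2) :
    ‖gibbsBarycenter η y (dataPotential η x y) u - popRegression η μ ν u‖ ^ 2 ≤
      2 * Real.exp (12 * η) * (
        ((n : ℝ)⁻¹ * ∑ i, ((n : ℝ)⁻¹ * ∑ j, (popDensity η μ ν (x i) (y j) - 1)) ^ 2) +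
        ((n : ℝ)⁻¹ * ∑ j, ((n : ℝ)⁻¹ * ∑ i, (popDensity η μ ν (x i) (y j) - 1)) ^ 2) +
        ((n : ℝ)⁻¹ * ‖∑ j, popDensity η μ ν u (y j) • (y j - popRegression η μ ν u)‖) ^ 2) := by
  have hn : (0 : ℝ) < n := Nat.cast_pos.2 (Nat.pos_of_ne_zero (NeZero.ne n))
  have hrow := dataPotential_row x y hη
  have hcol := dataPotential_col x y hη
  set a := dataPotentialLeft η x y
  set b := dataPotential η x y with hb
  set b₀ : Fin n → ℝ := fun j => popRight η μ ν (y j) with hb₀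
  have hosc : ∀ j k, b j - b k ≤ 1 := dataPotential_sub_le_one x y hη
  have hosc₀ : ∀ j k, b₀ j - b₀ k ≤ 1 := fun j k => popRight_sub_le_one hη _ _
  have h := norm_gibbsBarycenter_sub_le hη hy hosc hosc₀ hu
  have h' := norm_gibbsBarycenter_sub_popRegression_le (μ := μ) (ν := ν) hη hy hu
  set β : Fin n → ℝ := fun j => b j - b₀ j - (n : ℝ)⁻¹ * ∑ k, (b k - b₀ k)
  set V := (n : ℝ)⁻¹ * ‖∑ j, popDensity η μ ν u (y j) • (y j - popRegression η μ ν u)‖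
  have hm : ∀ i j, Real.exp (-2 * η) ≤ Real.exp (-η * (dataCost x y i j - a i - b j)) :=
    fun i j => (density_bounds (ν := unifMeasure n) (r := dataCost x y i) (g := b) (a := a i) hη
      (fun _ => truncCost_nonneg _ _) (fun _ => truncCost_le_one _ _) hosc
      (by rw [integral_unifMeasure, smul_eq_mul]; exact hrow i) j).1
  have hm₀ : ∀ i j, Real.exp (-2 * η)
      ≤ Real.exp (-η * (dataCost x y i j - popLeft η μ ν (x i) - b₀ j)) := fun i j =>
    (popDensity_bounds hη (x i) (y j)).1
  have hst := mean_sq_potential_le (a₀ := fun i => popLeft η μ ν (x i)) (b₀ := b₀) hη hrow hcol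
    (Real.exp_pos _) hm hm₀
  change (n : ℝ)⁻¹ * ∑ j, β j ^ 2 ≤ ((Real.exp (-2 * η) * η) ^ 2)⁻¹ * (
    ((n : ℝ)⁻¹ * ∑ i, ((n : ℝ)⁻¹ * ∑ j, (popDensity η μ ν (x i) (y j) - 1)) ^ 2) +
    ((n : ℝ)⁻¹ * ∑ j, ((n : ℝ)⁻¹ * ∑ i, (popDensity η μ ν (x i) (y j) - 1)) ^ 2)) at hst
  set RS := ((n : ℝ)⁻¹ * ∑ i, ((n : ℝ)⁻¹ * ∑ j, (popDensity η μ ν (x i) (y j) - 1)) ^ 2) +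
    ((n : ℝ)⁻¹ * ∑ j, ((n : ℝ)⁻¹ * ∑ i, (popDensity η μ ν (x i) (y j) - 1)) ^ 2)
  have hcs : ((n : ℝ)⁻¹ * ∑ j, |β j|) ^ 2 ≤ (n : ℝ)⁻¹ * ∑ j, β j ^ 2 := by
    have := sq_sum_le_card_mul_sum_sq (s := Finset.univ) (f := fun j => |β j|)
    simp only [sq_abs, Finset.card_univ, Fintype.card_fin] at this
    calc ((n : ℝ)⁻¹ * ∑ j, |β j|) ^ 2 = (n : ℝ)⁻¹ ^ 2 * (∑ j, |β j|) ^ 2 := mul_pow _ _ _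
      _ ≤ (n : ℝ)⁻¹ ^ 2 * (n * ∑ j, β j ^ 2) := by gcongr
      _ = _ := by field_simp
  have htri : ‖gibbsBarycenter η y b u - popRegression η μ ν u‖
      ≤ η * Real.exp (4 * η) * ((n : ℝ)⁻¹ * ∑ j, |β j|) + Real.exp (2 * η) * V :=
    (norm_sub_le_norm_sub_add_norm_sub _ (gibbsBarycenter η y b₀ u) _).trans (add_le_add h h')
  have hconst : (η * Real.exp (4 * η)) ^ 2 * ((Real.exp (-2 * η) * η) ^ 2)⁻¹
      = Real.exp (12 * η) := by
    rw [mul_pow, mul_pow, ← Real.exp_nat_mul, ← Real.exp_nat_mul, mul_inv, ← Real.exp_neg,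
      show Real.exp (12 * η) = Real.exp (((2 : ℕ) : ℝ) * (4 * η))
        * Real.exp (-(((2 : ℕ) : ℝ) * (-2 * η))) by rw [← Real.exp_add]; push_cast; ring_nf]
    field_simp
  have hexp : Real.exp (2 * η) ^ 2 ≤ Real.exp (12 * η) := by
    rw [← Real.exp_nat_mul]
    exact Real.exp_le_exp.2 (by push_cast; linarith)
  calc ‖gibbsBarycenter η y b u - popRegression η μ ν u‖ ^ 2
      ≤ (η * Real.exp (4 * η) * ((n : ℝ)⁻¹ * ∑ j, |β j|) + Real.exp (2 * η) * V) ^ 2 := by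
        gcongr
    _ ≤ 2 * ((η * Real.exp (4 * η) * ((n : ℝ)⁻¹ * ∑ j, |β j|)) ^ 2
          + (Real.exp (2 * η) * V) ^ 2) := add_sq_le
    _ ≤ 2 * ((η * Real.exp (4 * η)) ^ 2 * (((Real.exp (-2 * η) * η) ^ 2)⁻¹ * RS)
          + Real.exp (12 * η) * V ^ 2) := by
        rw [mul_pow _ ((n : ℝ)⁻¹ * _), mul_pow _ V]
        gcongr
        exact hcs.trans hst
    _ = 2 * Real.exp (12 * η) * (RS + V ^ 2) := by
        rw [← mul_assoc (_ ^ 2), hconst]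
        ring

end Data

/-! ### Exponential moment of the squared error -/

section ErrorMoment

variable {d n : ℕ} {η : ℝ} {μ ν : Measure (EuclideanSpace ℝ (Fin d))}
/-- The squared norm of the error at `u` for the data `z = (x, y)`, in terms of the potentials
constructed by Sinkhorn's iteration. -/
noncomputable def sqErrorAt (η : ℝ) (μ ν : Measure (EuclideanSpace ℝ (Fin d)))
    (z : (Fin n → EuclideanSpace ℝ (Fin d)) × (Fin n → EuclideanSpace ℝ (Fin d)))
    (u : EuclideanSpace ℝ (Fin d)) : ℝ :=
  ‖gibbsBarycenter η z.2 (dataPotential η z.1 z.2) u - popRegression η μ ν u‖ ^ 2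

/-- The squared `L²(μ)` error for the data `z = (x, y)`. -/
noncomputable def intSqError (η : ℝ) (μ ν : Measure (EuclideanSpace ℝ (Fin d)))
    (z : (Fin n → EuclideanSpace ℝ (Fin d)) × (Fin n → EuclideanSpace ℝ (Fin d))) : ℝ :=
  ∫ u, sqErrorAt η μ ν z u ∂μ

lemma sqErrorAt_nonneg
    (z : (Fin n → EuclideanSpace ℝ (Fin d)) × (Fin n → EuclideanSpace ℝ (Fin d)))
    (u : EuclideanSpace ℝ (Fin d)) : 0 ≤ sqErrorAt η μ ν z u := sq_nonneg _

variable [IsProbabilityMeasure μ] [IsProbabilityMeasure ν]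

lemma measurable_sqErrorAt [NeZero n] (hη : 0 < η) : Measurable
    fun q : ((Fin n → EuclideanSpace ℝ (Fin d)) × (Fin n → EuclideanSpace ℝ (Fin d))) ×
      EuclideanSpace ℝ (Fin d) => sqErrorAt η μ ν q.1 q.2 := by
  have hR := measurable_popRegression (μ := μ) (ν := ν) hη
  have hG : ∀ j, Measurable fun q : ((Fin n → EuclideanSpace ℝ (Fin d)) ×
      (Fin n → EuclideanSpace ℝ (Fin d))) × EuclideanSpace ℝ (Fin d) =>
        dataPotential η q.1.1 q.1.2 j := fun j =>
    (measurable_dataPotential hη j).comp measurable_fst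
  unfold sqErrorAt gibbsBarycenter
  fun_prop

lemma measurable_intSqError [NeZero n] (hη : 0 < η) :
    Measurable (intSqError (n := n) η μ ν) :=
  ((measurable_sqErrorAt hη).stronglyMeasurable.integral_prod_right' (ν := μ)).measurable

lemma sqErrorAt_le_one (hη : 0 < η) (hν : ∀ᵐ y ∂ν, ‖y‖ ≤ 1 / 2)
    {z : (Fin n → EuclideanSpace ℝ (Fin d)) × (Fin n → EuclideanSpace ℝ (Fin d))}
    (hz : ∀ j, ‖z.2 j‖ ≤ 1 / 2) (u : EuclideanSpace ℝ (Fin d)) : sqErrorAt η μ ν z u ≤ 1 :=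
  norm_sub_sq_le_one (norm_weighted_mean_le (fun j => (Real.exp_pos _).le) (by norm_num) hz)
    (norm_popRegression_le hη hν u)

lemma integrable_sqErrorAt [NeZero n] (hη : 0 < η) (hν : ∀ᵐ y ∂ν, ‖y‖ ≤ 1 / 2)
    {z : (Fin n → EuclideanSpace ℝ (Fin d)) × (Fin n → EuclideanSpace ℝ (Fin d))}
    (hz : ∀ j, ‖z.2 j‖ ≤ 1 / 2) : Integrable (sqErrorAt η μ ν z) μ := by
  refine Integrable.of_bound
    ((measurable_sqErrorAt hη).comp (measurable_prodMk_left (x := z))).aestronglyMeasurable 1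
    (ae_of_all _ fun u => ?_)
  rw [Real.norm_of_nonneg (sqErrorAt_nonneg z u)]
  exact sqErrorAt_le_one hη hν hz u

lemma sqError_eq [NeZero n] (hη : 0 < η) (hμ : ∀ᵐ x ∂μ, ‖x‖ ≤ 1 / 2)
    (hν : ∀ᵐ y ∂ν, ‖y‖ ≤ 1 / 2)
    {z : (Fin n → EuclideanSpace ℝ (Fin d)) × (Fin n → EuclideanSpace ℝ (Fin d))}
    (hz1 : ∀ i, ‖z.1 i‖ ≤ 1 / 2) (hz2 : ∀ j, ‖z.2 j‖ ≤ 1 / 2) :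
    sqError η μ ν z.1 z.2 = ENNReal.ofReal (intSqError η μ ν z) := by
  have h := eLpNorm_nnreal_pow_eq_lintegral (μ := μ) (p := 2) two_ne_zero
    (f := fun u => empRegression η z.1 z.2 u - regression η μ ν u)
  simp only [ENNReal.coe_ofNat, NNReal.coe_ofNat, ENNReal.rpow_ofNat] at h
  rw [sqError, h, intSqError, ofReal_integral_eq_lintegral_ofReal (integrable_sqErrorAt hη hν hz2)
    (ae_of_all _ fun u => sqErrorAt_nonneg z u)]
  refine lintegral_congr_ae ?_
  filter_upwards [regression_ae_eq hη hμ hν] with u hu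
  rw [hu, empRegression_eq hη hz1 hz2, sqErrorAt, ENNReal.ofReal_pow (norm_nonneg _), ofReal_norm]

/-- Exponential moment of the fluctuation of the empirical mean of the density in the second
variable. -/
lemma lintegral_exp_popDensity_right_le [NeZero n] (hη : 0 < η) (u : EuclideanSpace ℝ (Fin d)) :
    ∫⁻ y, ENNReal.ofReal (Real.exp ((8 * n * Real.exp (4 * η))⁻¹ *
      (∑ j, (popDensity η μ ν u (y j) - 1)) ^ 2)) ∂(Measure.pi fun _ : Fin n => ν) ≤ 2 := by
  have h0 := (measurable_popDensity (μ := μ) (ν := ν) hη).comp (measurable_prodMk_left (x := u))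
  have hm : Measurable fun v => popDensity η μ ν u v - 1 := h0.sub_const 1
  have hi : Integrable (popDensity η μ ν u) ν := by
    by_contra h
    have h1 := integral_popDensity_right (μ := μ) (ν := ν) hη u
    rw [integral_undef h] at h1
    exact zero_ne_one h1
  have hn : (n : ℝ) ≠ 0 := by simp [NeZero.ne n]
  have := lintegral_exp_norm_sum_sq_le (ν := ν) hm (B := Real.exp (2 * η))
    (ae_of_all _ fun v => ?_) ?_ n (a := (8 * n * Real.exp (4 * η))⁻¹) (by positivity) ?_
  · simpa only [Real.norm_eq_abs, sq_abs] using this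
  · obtain ⟨h1, h2⟩ := popDensity_bounds (μ := μ) (ν := ν) hη u v
    have := Real.one_le_exp (by linarith : 0 ≤ 2 * η)
    have := popDensity_nonneg (η := η) (μ := μ) (ν := ν) u v
    rw [Real.norm_eq_abs, abs_le]
    constructor <;> linarith
  · rw [integral_sub hi (integrable_const _), integral_popDensity_right hη]
    simp
  · rw [← Real.exp_nat_mul, show ((2 : ℕ) : ℝ) * (2 * η) = 4 * η by push_cast; ring]
    field_simp
    rfl

lemma lintegral_exp_popDensity_left_le [NeZero n] (hη : 0 < η) (v : EuclideanSpace ℝ (Fin d)) :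
    ∫⁻ x, ENNReal.ofReal (Real.exp ((8 * n * Real.exp (4 * η))⁻¹ *
      (∑ i, (popDensity η μ ν (x i) v - 1)) ^ 2)) ∂(Measure.pi fun _ : Fin n => μ) ≤ 2 := by
  have h0 := (measurable_popDensity (μ := μ) (ν := ν) hη).comp (measurable_prodMk_right (y := v))
  have hm : Measurable fun u => popDensity η μ ν u v - 1 := h0.sub_const 1
  have hi : Integrable (fun u => popDensity η μ ν u v) μ := by
    by_contra h
    have h1 := integral_popDensity_left (μ := μ) (ν := ν) hη v
    rw [integral_undef h] at h1
    exact zero_ne_one h1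
  have hn : (n : ℝ) ≠ 0 := by simp [NeZero.ne n]
  have := lintegral_exp_norm_sum_sq_le (ν := μ) hm (B := Real.exp (2 * η))
    (ae_of_all _ fun u => ?_) ?_ n (a := (8 * n * Real.exp (4 * η))⁻¹) (by positivity) ?_
  · simpa only [Real.norm_eq_abs, sq_abs] using this
  · obtain ⟨h1, h2⟩ := popDensity_bounds (μ := μ) (ν := ν) hη u v
    have := Real.one_le_exp (by linarith : 0 ≤ 2 * η)
    have := popDensity_nonneg (η := η) (μ := μ) (ν := ν) u v
    rw [Real.norm_eq_abs, abs_le]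
    constructor <;> linarith
  · rw [integral_sub hi (integrable_const _), integral_popDensity_left hη]
    simp
  · rw [← Real.exp_nat_mul, show ((2 : ℕ) : ℝ) * (2 * η) = 4 * η by push_cast; ring]
    field_simp
    rfl

/-- Exponential moment of the fluctuation of the vector-valued empirical mean at `u`. -/
lemma lintegral_exp_popRegression_le [NeZero n] (hη : 0 < η) (hν : ∀ᵐ y ∂ν, ‖y‖ ≤ 1 / 2)
    (u : EuclideanSpace ℝ (Fin d)) :
    ∫⁻ y, ENNReal.ofReal (Real.exp ((8 * n * Real.exp (4 * η))⁻¹ *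
      ‖∑ j, popDensity η μ ν u (y j) • (y j - popRegression η μ ν u)‖ ^ 2))
        ∂(Measure.pi fun _ : Fin n => ν) ≤ 2 := by
  have h0 := (measurable_popDensity (μ := μ) (ν := ν) hη).comp (measurable_prodMk_left (x := u))
  have h0' : Measurable fun v => popDensity η μ ν u v := h0
  have hm : Measurable fun v => popDensity η μ ν u v • (v - popRegression η μ ν u) := by
    fun_prop
  have hi : Integrable (popDensity η μ ν u) ν := by
    by_contra h
    have h1 := integral_popDensity_right (μ := μ) (ν := ν) hη u
    rw [integral_undef h] at h1
    exact zero_ne_one h1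
  have hi2 : Integrable (fun v => popDensity η μ ν u v • v) ν := by
    refine Integrable.of_bound (h0'.smul measurable_id).aestronglyMeasurable
      (Real.exp (2 * η) * (1 / 2)) ?_
    filter_upwards [hν] with v hv
    rw [norm_smul, Real.norm_of_nonneg (popDensity_nonneg u v)]
    have := (popDensity_bounds (μ := μ) (ν := ν) hη u v).2
    gcongr
  have hn : (n : ℝ) ≠ 0 := by simp [NeZero.ne n]
  refine lintegral_exp_norm_sum_sq_le (ν := ν) hm (B := Real.exp (2 * η)) ?_ ?_ n
    (by positivity) ?_
  · filter_upwards [hν] with v hv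
    rw [norm_smul, Real.norm_of_nonneg (popDensity_nonneg u v)]
    have h1 := (popDensity_bounds (μ := μ) (ν := ν) hη u v).2
    have h2 : ‖v - popRegression η μ ν u‖ ≤ 1 :=
      (norm_sub_le _ _).trans (by linarith [norm_popRegression_le (μ := μ) (ν := ν) hη hν u])
    calc _ ≤ Real.exp (2 * η) * 1 := by gcongr
      _ = _ := mul_one _
  · simp_rw [smul_sub]
    rw [integral_sub hi2 (hi.smul_const _), integral_smul_const, integral_popDensity_right hη,
      one_smul]
    exact sub_self _
  · rw [← Real.exp_nat_mul, show ((2 : ℕ) : ℝ) * (2 * η) = 4 * η by push_cast; ring]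
    field_simp
    rfl

/-- The constant of the exponential moment bound for the squared error: a factor `3` for averaging
the three kinds of sums, `2 exp(12η)` from the deterministic error bound, and `8 exp(4η)` from the
exponential moment of each sum. -/
noncomputable def momentConst (η : ℝ) : ℝ := 48 * Real.exp (16 * η)

lemma momentConst_pos (η : ℝ) : 0 < momentConst η := by
  unfold momentConst
  positivity

lemma exp_mean_le [NeZero n] (f : Fin n → ℝ) :
    Real.exp ((n : ℝ)⁻¹ * ∑ i, f i) ≤ (n : ℝ)⁻¹ * ∑ i, Real.exp (f i) := by
  have hn : (n : ℝ) ≠ 0 := by simp [NeZero.ne n]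
  have h := convexOn_exp.map_sum_le (t := Finset.univ) (w := fun _ : Fin n => (n : ℝ)⁻¹) (p := f)
    (fun _ _ => by positivity) (by simp [hn]) (fun _ _ => Set.mem_univ _)
  simpa only [smul_eq_mul, ← Finset.mul_sum] using h

lemma exp_third_le (a b c : ℝ) :
    Real.exp ((a + b + c) / 3) ≤ (Real.exp a + Real.exp b + Real.exp c) / 3 := by
  have h := exp_mean_le ![a, b, c]
  simp only [Fin.sum_univ_three, Matrix.cons_val_zero, Matrix.cons_val_one, Matrix.cons_val_two,
    Matrix.head_cons, Matrix.tail_cons] at h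
  rwa [inv_mul_eq_div, inv_mul_eq_div] at h

/-- The exponential of the scaled squared error is dominated by an average of exponentials of
squared sums of independent centred variables. -/
lemma exp_sqErrorAt_le [NeZero n] (hη : 0 < η) {x y : Fin n → EuclideanSpace ℝ (Fin d)}
    (hy : ∀ j, ‖y j‖ ≤ 1 / 2) {u : EuclideanSpace ℝ (Fin d)} (hu : ‖u‖ ≤ 1 / 2) :
    Real.exp (n / momentConst η * sqErrorAt η μ ν (x, y) u) ≤
      ((n : ℝ)⁻¹ * (∑ i, Real.exp ((8 * n * Real.exp (4 * η))⁻¹ *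
          (∑ j, (popDensity η μ ν (x i) (y j) - 1)) ^ 2)) +
        (n : ℝ)⁻¹ * (∑ j, Real.exp ((8 * n * Real.exp (4 * η))⁻¹ *
          (∑ i, (popDensity η μ ν (x i) (y j) - 1)) ^ 2)) +
        Real.exp ((8 * n * Real.exp (4 * η))⁻¹ *
          ‖∑ j, popDensity η μ ν u (y j) • (y j - popRegression η μ ν u)‖ ^ 2)) / 3 := by
  have hn : (0 : ℝ) < n := Nat.cast_pos.2 (Nat.pos_of_ne_zero (NeZero.ne n))
  have h := sq_norm_gibbsBarycenter_sub_popRegression_le (μ := μ) (ν := ν) hη (x := x) hy hu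
  have e16 : Real.exp (16 * η) = Real.exp (12 * η) * Real.exp (4 * η) := by
    rw [← Real.exp_add]; ring_nf
  refine le_trans (Real.exp_le_exp.2 ?_) ((exp_third_le
    ((n : ℝ)⁻¹ * ∑ i, (8 * n * Real.exp (4 * η))⁻¹ *
      (∑ j, (popDensity η μ ν (x i) (y j) - 1)) ^ 2)
    ((n : ℝ)⁻¹ * ∑ j, (8 * n * Real.exp (4 * η))⁻¹ *
      (∑ i, (popDensity η μ ν (x i) (y j) - 1)) ^ 2)
    ((8 * n * Real.exp (4 * η))⁻¹ *
      ‖∑ j, popDensity η μ ν u (y j) • (y j - popRegression η μ ν u)‖ ^ 2)).trans ?_)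
  · refine (mul_le_mul_of_nonneg_left h (by have := momentConst_pos η; positivity)).trans_eq ?_
    rw [momentConst, e16]
    simp_rw [mul_pow]
    simp only [← Finset.mul_sum]
    field_simp
    ring
  · gcongr
    · exact exp_mean_le _
    · exact exp_mean_le _

lemma ae_pi_forall_norm_le {ρ : Measure (EuclideanSpace ℝ (Fin d))} [IsProbabilityMeasure ρ]
    (hρ : ∀ᵐ x ∂ρ, ‖x‖ ≤ 1 / 2) :
    ∀ᵐ x ∂(Measure.pi fun _ : Fin n => ρ), ∀ i, ‖x i‖ ≤ 1 / 2 :=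
  ae_all_iff.2 fun i => (measurePreserving_eval (fun _ : Fin n => ρ) i).quasiMeasurePreserving.ae hρ

lemma ae_prod_forall_norm_le (hμ : ∀ᵐ x ∂μ, ‖x‖ ≤ 1 / 2) (hν : ∀ᵐ y ∂ν, ‖y‖ ≤ 1 / 2) :
    ∀ᵐ z ∂((Measure.pi fun _ : Fin n => μ).prod (Measure.pi fun _ : Fin n => ν)),
      (∀ i, ‖z.1 i‖ ≤ 1 / 2) ∧ ∀ j, ‖z.2 j‖ ≤ 1 / 2 := by
  filter_upwards [Measure.quasiMeasurePreserving_fst.ae (ae_pi_forall_norm_le hμ),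
    Measure.quasiMeasurePreserving_snd.ae (ae_pi_forall_norm_le hν)] with z h1 h2 using ⟨h1, h2⟩

lemma measurable_popDensity_comp (hη : 0 < η) {γ : Type*} [MeasurableSpace γ]
    {f g : γ → EuclideanSpace ℝ (Fin d)} (hf : Measurable f) (hg : Measurable g) :
    Measurable fun q => popDensity η μ ν (f q) (g q) := by
  have h0 := measurable_popDensity (μ := μ) (ν := ν) hη
  have h := h0.comp (hf.prodMk hg)
  exact h

lemma lintegral_ofReal_inv_mul_sum_le {γ : Type*} [MeasurableSpace γ] [NeZero n] {ρ : Measure γ}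
    {F : Fin n → γ → ℝ} (hF : ∀ i, Measurable (F i)) (h0 : ∀ i q, 0 ≤ F i q)
    (h2 : ∀ i, ∫⁻ q, ENNReal.ofReal (F i q) ∂ρ ≤ 2) :
    ∫⁻ q, ENNReal.ofReal ((n : ℝ)⁻¹ * ∑ i, F i q) ∂ρ ≤ 2 := by
  have hn : (0 : ℝ) < n := Nat.cast_pos.2 (Nat.pos_of_ne_zero (NeZero.ne n))
  have e : ∀ q, ENNReal.ofReal ((n : ℝ)⁻¹ * ∑ i, F i q)
      = (n : ℝ≥0∞)⁻¹ * ∑ i, ENNReal.ofReal (F i q) := fun q => by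
    rw [ENNReal.ofReal_mul (by positivity), ENNReal.ofReal_sum_of_nonneg fun i _ => h0 i q,
      ENNReal.ofReal_inv_of_pos hn, ENNReal.ofReal_natCast]
  simp_rw [e]
  rw [lintegral_const_mul _ (Finset.measurable_sum _ fun i _ => (hF i).ennreal_ofReal),
    lintegral_finsetSum _ fun i _ => (hF i).ennreal_ofReal]
  calc (n : ℝ≥0∞)⁻¹ * ∑ i, ∫⁻ q, ENNReal.ofReal (F i q) ∂ρ
      ≤ (n : ℝ≥0∞)⁻¹ * ∑ _i : Fin n, 2 := by gcongr with i; exact h2 i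
    _ = 2 := by
      rw [Finset.sum_const, Finset.card_univ, Fintype.card_fin, nsmul_eq_mul, ← mul_assoc,
        ENNReal.inv_mul_cancel (by simp [NeZero.ne n]) (by simp), one_mul]

/-- For a fixed point `u` of the ball, the scaled squared error at `u` has a bounded exponential
moment. -/
lemma lintegral_exp_sqErrorAt_le [NeZero n] (hη : 0 < η) (hμ : ∀ᵐ x ∂μ, ‖x‖ ≤ 1 / 2)
    (hν : ∀ᵐ y ∂ν, ‖y‖ ≤ 1 / 2) {u : EuclideanSpace ℝ (Fin d)} (hu : ‖u‖ ≤ 1 / 2) :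
    ∫⁻ z, ENNReal.ofReal (Real.exp (n / momentConst η * sqErrorAt η μ ν z u))
      ∂((Measure.pi fun _ : Fin n => μ).prod (Measure.pi fun _ : Fin n => ν)) ≤ 2 := by
  set Q := (Measure.pi fun _ : Fin n => μ).prod (Measure.pi fun _ : Fin n => ν) with hQ
  set a := (8 * n * Real.exp (4 * η))⁻¹ with ha
  have mp : ∀ i j, Measurable
      fun z : (Fin n → EuclideanSpace ℝ (Fin d)) × (Fin n → EuclideanSpace ℝ (Fin d)) =>
        popDensity η μ ν (z.1 i) (z.2 j) := fun i j =>
    measurable_popDensity_comp hη (by fun_prop) (by fun_prop)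
  have mpu : ∀ j, Measurable
      fun z : (Fin n → EuclideanSpace ℝ (Fin d)) × (Fin n → EuclideanSpace ℝ (Fin d)) =>
        popDensity η μ ν u (z.2 j) := fun j =>
    measurable_popDensity_comp hη (by fun_prop) (by fun_prop)
  let A : Fin n → (Fin n → EuclideanSpace ℝ (Fin d)) × (Fin n → EuclideanSpace ℝ (Fin d)) → ℝ :=
    fun i z => Real.exp (a * (∑ j, (popDensity η μ ν (z.1 i) (z.2 j) - 1)) ^ 2)
  let B : Fin n → (Fin n → EuclideanSpace ℝ (Fin d)) × (Fin n → EuclideanSpace ℝ (Fin d)) → ℝ :=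
    fun j z => Real.exp (a * (∑ i, (popDensity η μ ν (z.1 i) (z.2 j) - 1)) ^ 2)
  let D : (Fin n → EuclideanSpace ℝ (Fin d)) × (Fin n → EuclideanSpace ℝ (Fin d)) → ℝ :=
    fun z => Real.exp (a *
      ‖∑ j, popDensity η μ ν u (z.2 j) • (z.2 j - popRegression η μ ν u)‖ ^ 2)
  have mA : ∀ i, Measurable (A i) := fun i => by
    have := mp i
    fun_prop
  have mB : ∀ j, Measurable (B j) := fun j => by
    have := fun i => mp i j
    fun_prop
  have mD : Measurable D := by
    have h : Measurable
        fun z : (Fin n → EuclideanSpace ℝ (Fin d)) × (Fin n → EuclideanSpace ℝ (Fin d)) =>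
          ∑ j, popDensity η μ ν u (z.2 j) • (z.2 j - popRegression η μ ν u) :=
      Finset.measurable_sum _ fun j _ => (mpu j).smul (by fun_prop)
    exact Real.measurable_exp.comp ((h.norm.pow_const 2).const_mul a)
  have iA : ∀ i, ∫⁻ z, ENNReal.ofReal (A i z) ∂Q ≤ 2 := fun i => by
    have h : ∀ x, ∫⁻ y, ENNReal.ofReal (A i (x, y)) ∂(Measure.pi fun _ : Fin n => ν) ≤ 2 :=
      fun x => by
        have := lintegral_exp_popDensity_right_le (n := n) (μ := μ) (ν := ν) hη (x i)
        exact this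
    rw [hQ, lintegral_prod _ (mA i).ennreal_ofReal.aemeasurable]
    exact (lintegral_mono (g := fun _ => 2) h).trans (by simp)
  have iB : ∀ j, ∫⁻ z, ENNReal.ofReal (B j z) ∂Q ≤ 2 := fun j => by
    have h : ∀ y, ∫⁻ x, ENNReal.ofReal (B j (x, y)) ∂(Measure.pi fun _ : Fin n => μ) ≤ 2 :=
      fun y => by
        have := lintegral_exp_popDensity_left_le (n := n) (μ := μ) (ν := ν) hη (y j)
        exact this
    rw [hQ, lintegral_prod_symm _ (mB j).ennreal_ofReal.aemeasurable]
    exact (lintegral_mono (g := fun _ => 2) h).trans (by simp)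
  have iD : ∫⁻ z, ENNReal.ofReal (D z) ∂Q ≤ 2 := by
    have h : ∀ x, ∫⁻ y, ENNReal.ofReal (D (x, y)) ∂(Measure.pi fun _ : Fin n => ν) ≤ 2 :=
      fun x => by
        have := lintegral_exp_popRegression_le (n := n) (μ := μ) (ν := ν) hη hν u
        exact this
    rw [hQ, lintegral_prod _ mD.ennreal_ofReal.aemeasurable]
    exact (lintegral_mono (g := fun _ => 2) h).trans (by simp)
  have hA := lintegral_ofReal_inv_mul_sum_le mA (fun i z => (Real.exp_pos _).le) iA
  have hB := lintegral_ofReal_inv_mul_sum_le mB (fun i z => (Real.exp_pos _).le) iB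
  have hle : ∀ᵐ z ∂Q, ENNReal.ofReal (Real.exp (n / momentConst η * sqErrorAt η μ ν z u)) ≤
      (3 : ℝ≥0∞)⁻¹ * (ENNReal.ofReal ((n : ℝ)⁻¹ * ∑ i, A i z)
        + ENNReal.ofReal ((n : ℝ)⁻¹ * ∑ j, B j z) + ENNReal.ofReal (D z)) := by
    filter_upwards [ae_prod_forall_norm_le hμ hν] with z hz
    refine (ENNReal.ofReal_le_ofReal (exp_sqErrorAt_le hη hz.2 hu)).trans_eq ?_
    have pA : 0 ≤ (n : ℝ)⁻¹ * ∑ i, A i z := by positivity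
    have pB : 0 ≤ (n : ℝ)⁻¹ * ∑ j, B j z := by positivity
    have pD : 0 ≤ D z := (Real.exp_pos _).le
    rw [← ENNReal.ofReal_add pA pB, ← ENNReal.ofReal_add (add_nonneg pA pB) pD, div_eq_inv_mul,
      ENNReal.ofReal_mul (by norm_num), ENNReal.ofReal_inv_of_pos (by norm_num)]
    simp only [ENNReal.ofReal_ofNat]
    rfl
  refine (lintegral_mono_ae hle).trans ?_
  have m2 : Measurable fun z => ENNReal.ofReal ((n : ℝ)⁻¹ * ∑ j, B j z) := by fun_prop
  rw [lintegral_const_mul' _ _ (by norm_num), lintegral_add_right _ mD.ennreal_ofReal,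
    lintegral_add_right _ m2]
  calc _ ≤ (3 : ℝ≥0∞)⁻¹ * (2 + 2 + 2) := by gcongr
    _ = 2 := by
      rw [show (2 + 2 + 2 : ℝ≥0∞) = 3 * 2 by norm_num, ← mul_assoc,
        ENNReal.inv_mul_cancel (by norm_num) (by norm_num), one_mul]

/-- The scaled squared `L²(μ)` error has a bounded exponential moment. Jensen's inequality
exchanges the exponential and the integral over `μ`, so that only the concentration at fixed points
is needed. -/
lemma lintegral_exp_intSqError_le [NeZero n] (hη : 0 < η) (hμ : ∀ᵐ x ∂μ, ‖x‖ ≤ 1 / 2)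
    (hν : ∀ᵐ y ∂ν, ‖y‖ ≤ 1 / 2) :
    ∫⁻ z, ENNReal.ofReal (Real.exp (n / momentConst η * intSqError η μ ν z))
      ∂((Measure.pi fun _ : Fin n => μ).prod (Measure.pi fun _ : Fin n => ν)) ≤ 2 := by
  have hC := momentConst_pos η
  have hjensen : ∀ᵐ z ∂((Measure.pi fun _ : Fin n => μ).prod (Measure.pi fun _ : Fin n => ν)),
      ENNReal.ofReal (Real.exp (n / momentConst η * intSqError η μ ν z)) ≤
        ∫⁻ u, ENNReal.ofReal (Real.exp (n / momentConst η * sqErrorAt η μ ν z u)) ∂μ := by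
    filter_upwards [ae_prod_forall_norm_le hμ hν] with z hz
    have hi := integrable_sqErrorAt (μ := μ) hη hν hz.2
    have hi2 : Integrable (fun u => Real.exp (n / momentConst η * sqErrorAt η μ ν z u)) μ := by
      refine Integrable.of_bound (Real.continuous_exp.comp_aestronglyMeasurable
        (hi.aestronglyMeasurable.const_mul _)) (Real.exp (n / momentConst η * 1))
        (ae_of_all _ fun u => ?_)
      rw [Real.norm_eq_abs, Real.abs_exp]
      refine Real.exp_le_exp.2 (mul_le_mul_of_nonneg_left ?_ (by positivity))
      exact sqErrorAt_le_one hη hν hz.2 u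
    rw [← ofReal_integral_eq_lintegral_ofReal hi2 (ae_of_all _ fun u => (Real.exp_pos _).le)]
    refine ENNReal.ofReal_le_ofReal ?_
    rw [intSqError, ← integral_const_mul]
    exact convexOn_exp.map_integral_le Real.continuous_exp.continuousOn isClosed_univ
      (ae_of_all _ fun _ => Set.mem_univ _) (hi.const_mul _) hi2
  have hm : Measurable fun q : ((Fin n → EuclideanSpace ℝ (Fin d)) ×
      (Fin n → EuclideanSpace ℝ (Fin d))) × EuclideanSpace ℝ (Fin d) =>
        ENNReal.ofReal (Real.exp (n / momentConst η * sqErrorAt η μ ν q.1 q.2)) := by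
    have := measurable_sqErrorAt (n := n) (μ := μ) (ν := ν) hη
    fun_prop
  refine (lintegral_mono_ae hjensen).trans ?_
  rw [lintegral_lintegral_swap hm.aemeasurable]
  refine (lintegral_mono_ae (g := fun _ => 2) ?_).trans (by simp)
  filter_upwards [hμ] with u hu using lintegral_exp_sqErrorAt_le hη hμ hν hu

end ErrorMoment

section Deviation

variable {Ω : Type*} [MeasurableSpace Ω] {P : Measure Ω} {W : Ω → ℝ} {s : ℝ}

/-- An exponential moment bounds the mean. -/
lemma lintegral_ofReal_le_of_exp_moment (hs : 0 < s)
    (h : ∫⁻ ω, ENNReal.ofReal (Real.exp (s * W ω)) ∂P ≤ 2) :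
    ∫⁻ ω, ENNReal.ofReal (W ω) ∂P ≤ ENNReal.ofReal (2 / s) := by
  calc ∫⁻ ω, ENNReal.ofReal (W ω) ∂P
      ≤ ∫⁻ ω, ENNReal.ofReal s⁻¹ * ENNReal.ofReal (Real.exp (s * W ω)) ∂P := by
        refine lintegral_mono fun ω => ?_
        rw [← ENNReal.ofReal_mul (by positivity)]
        refine ENNReal.ofReal_le_ofReal ?_
        rw [inv_mul_eq_div, le_div_iff₀ hs]
        linarith [Real.add_one_le_exp (s * W ω)]
    _ = ENNReal.ofReal s⁻¹ * ∫⁻ ω, ENNReal.ofReal (Real.exp (s * W ω)) ∂P :=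
        lintegral_const_mul' _ _ ENNReal.ofReal_ne_top
    _ ≤ ENNReal.ofReal s⁻¹ * 2 := by gcongr
    _ = ENNReal.ofReal (2 / s) := by
        rw [← ENNReal.ofReal_ofNat 2, ← ENNReal.ofReal_mul (by positivity)]
        congr 1
        ring

/-- An exponential moment bounds the tail. -/
lemma measure_le_of_exp_moment [IsProbabilityMeasure P] (hs : 0 < s) (hW : AEMeasurable W P)
    (h : ∫⁻ ω, ENNReal.ofReal (Real.exp (s * W ω)) ∂P ≤ 2) (t : ℝ) :
    ENNReal.ofReal (1 - 2 * Real.exp (-t)) ≤ P {ω | W ω ≤ t / s} := by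
  have hsub : {ω | W ω ≤ t / s}ᶜ
      ⊆ {ω | ENNReal.ofReal (Real.exp t) ≤ ENNReal.ofReal (Real.exp (s * W ω))} := by
    intro ω hω
    simp only [Set.mem_compl_iff, Set.mem_ofPred_eq, not_le] at hω ⊢
    refine ENNReal.ofReal_le_ofReal (Real.exp_le_exp.2 ?_)
    rw [div_lt_iff₀ hs] at hω
    linarith
  have hmk : P {ω | W ω ≤ t / s}ᶜ ≤ ENNReal.ofReal (2 * Real.exp (-t)) := by
    refine (measure_mono hsub).trans ((meas_ge_le_lintegral_div
      (Real.measurable_exp.comp_aemeasurable (hW.const_mul s)).ennreal_ofReal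
      (by simp [Real.exp_pos]) ENNReal.ofReal_ne_top).trans ?_)
    rw [Real.exp_neg, ← div_eq_mul_inv, ENNReal.ofReal_div_of_pos (Real.exp_pos t)]
    refine ENNReal.div_le_div_right (h.trans_eq ?_) _
    simp
  have hone : (1 : ℝ≥0∞) ≤ P {ω | W ω ≤ t / s} + ENNReal.ofReal (2 * Real.exp (-t)) := by
    rw [← measure_univ (μ := P), ← Set.union_compl_self {ω | W ω ≤ t / s}]
    exact (measure_union_le _ _).trans (by gcongr)
  rw [ENNReal.ofReal_sub _ (by positivity), ENNReal.ofReal_one]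
  exact tsub_le_iff_right.2 hone

end Deviation

end EntropicOT

theorem mainTheorem2 (η : ℝ) (hη : 0 < η) :
    ∃ C : ℝ, 0 < C ∧
      ∀ (d n : ℕ), 1 ≤ n →
      ∀ (μ ν : Measure (EuclideanSpace ℝ (Fin d))),
        IsProbabilityMeasure μ → IsProbabilityMeasure ν →
        (∀ᵐ x ∂μ, ‖x‖ ≤ 1 / 2) → (∀ᵐ y ∂ν, ‖y‖ ≤ 1 / 2) →
      ∀ (Ω : Type*) [MeasurableSpace Ω] (P : Measure Ω) [IsProbabilityMeasure P]
        (X Y : Fin n → Ω → EuclideanSpace ℝ (Fin d)),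
        (∀ i, AEMeasurable (X i) P) → (∀ i, P.map (X i) = μ) → iIndepFun X P →
        (∀ j, AEMeasurable (Y j) P) → (∀ j, P.map (Y j) = ν) → iIndepFun Y P →
        IndepFun (fun ω i => X i ω) (fun ω j => Y j ω) P →
        AEMeasurable
          (fun ω => EntropicOT.sqError η μ ν (fun i => X i ω) (fun j => Y j ω)) P ∧
        ∫⁻ ω, EntropicOT.sqError η μ ν (fun i => X i ω) (fun j => Y j ω) ∂P ≤
          ENNReal.ofReal (C / n) ∧
        ∀ t : ℝ, 0 < t →
          ENNReal.ofReal (1 - 8 * Real.exp (-t)) ≤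
            P {ω | EntropicOT.sqError η μ ν (fun i => X i ω) (fun j => Y j ω) ≤
              ENNReal.ofReal (C * t / n)} := by
  have hC := EntropicOT.momentConst_pos η
  refine ⟨2 * EntropicOT.momentConst η, by positivity, ?_⟩
  intro d n hn μ ν _ _ hμ hν Ω _ P _ X Y hX hXμ hXi hY hYν hYi hXY
  have : NeZero n := ⟨by omega⟩
  have hn' : (0 : ℝ) < n := Nat.cast_pos.2 hn
  set Z : Ω → (Fin n → EuclideanSpace ℝ (Fin d)) × (Fin n → EuclideanSpace ℝ (Fin d)) :=
    fun ω => (fun i => X i ω, fun j => Y j ω) with hZ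
  have hXm : AEMeasurable (fun ω i => X i ω) P := aemeasurable_pi_lambda _ hX
  have hYm : AEMeasurable (fun ω j => Y j ω) P := aemeasurable_pi_lambda _ hY
  have hZm : AEMeasurable Z P := hXm.prodMk hYm
  have hlaw : P.map Z
      = (Measure.pi fun _ : Fin n => μ).prod (Measure.pi fun _ : Fin n => ν) := by
    rw [hZ, hXY.map_prod_eq_prod_map_map hXm hYm, (iIndepFun_iff_map_fun_eq_pi_map hX).1 hXi,
      (iIndepFun_iff_map_fun_eq_pi_map hY).1 hYi]
    simp_rw [hXμ, hYν]
  have hgood := EntropicOT.ae_prod_forall_norm_le (n := n) hμ hν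
  rw [← hlaw] at hgood
  have hsq : (fun ω => EntropicOT.sqError η μ ν (fun i => X i ω) (fun j => Y j ω))
      =ᵐ[P] fun ω => ENNReal.ofReal (EntropicOT.intSqError η μ ν (Z ω)) := by
    filter_upwards [ae_of_ae_map hZm hgood] with ω hω
    exact EntropicOT.sqError_eq hη hμ hν (z := Z ω) hω.1 hω.2
  have hWm : AEMeasurable (fun ω => EntropicOT.intSqError η μ ν (Z ω)) P :=
    (EntropicOT.measurable_intSqError hη).comp_aemeasurable hZm
  have hexp : ∫⁻ ω, ENNReal.ofReal
      (Real.exp (n / EntropicOT.momentConst η * EntropicOT.intSqError η μ ν (Z ω))) ∂P ≤ 2 := by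
    have h := EntropicOT.lintegral_exp_intSqError_le (n := n) hη hμ hν
    rw [← hlaw, lintegral_map' _ hZm] at h
    · exact h
    · have := EntropicOT.measurable_intSqError (n := n) (μ := μ) (ν := ν) hη
      exact Measurable.aemeasurable (by fun_prop)
  have hs : 0 < n / EntropicOT.momentConst η := by positivity
  refine ⟨hWm.ennreal_ofReal.congr hsq.symm, ?_, fun t ht => ?_⟩
  · rw [lintegral_congr_ae hsq]
    refine (EntropicOT.lintegral_ofReal_le_of_exp_moment hs hexp).trans_eq ?_
    congr 1
    field_simp
  · refine (ENNReal.ofReal_le_ofReal ?_).trans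
      ((EntropicOT.measure_le_of_exp_moment hs hWm hexp t).trans (measure_mono_ae ?_))
    · linarith [Real.exp_pos (-t)]
    · filter_upwards [hsq] with ω hω hle
      change EntropicOT.sqError η μ ν (fun i => X i ω) (fun j => Y j ω) ≤ _
      rw [hω]
      refine ENNReal.ofReal_le_ofReal (le_trans hle ?_)
      rw [div_div_eq_mul_div]
      refine div_le_div_of_nonneg_right ?_ hn'.le
      nlinarith [mul_pos hC ht]
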